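/- Let $\mathbf k$ be an algebraically closed field of characteristic $p>0$, and let $X=(\mathbb P^2,\Delta_X)$ where $\Delta_X$ is the curve $\sigma(x_0,x_1)-x_2^p=0$ with $\sigma(A,B)=\sum_{i=1}^{p-1}\sigma_iA^iB^{p-i}$, $\sigma_i\in\mathbf k$, $\sigma_1=\sigma_{p-1}=1$; write $\Delta_X$ also for the polynomial $\sigma(x_0,x_1)-x_2^p$, and put $\mathbf{str}=[0:0:1]$. An $\mathbb A^1$-curve of degree $d\ge 1$ in $X$ is a morphism $f\colon\mathbb P^1\to\mathbb P^2$ of degree $d$ with $f^{-1}(\Delta_X)=\{\infty\}$ as a set. Let $\mathscr A_{pd}(X)$ be the moduli of these curves (up to automorphisms of $(\mathbb P^1,\infty)$), and let $\mathscr A_{pd,m}(X)$ be the Zariski closure in it of the locus of curves whose multiplicity at $\mathbf{str}$, i.e. the degree of the scheme $f^{-1}(\mathbf{str})$, equals $m$. Let $d\ge p$ and let $f$ be an $\mathbb A^1$-curve in $\mathscr A_{pd,d-p}(X)$. For $a_j,b_0,b_1,c_0,c_1\in\mathbf k$ put $$L_k:=c_kx_0-b_kx_1\ (k=0,1),\qquad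 \pi:=b_1c_0-b_0c_1,$$ $$M(t)=\prod_{j=1}^{d-p}(t+a_j),\quad V(t)=b_0^{1/p}+b_1^{1/p}t,\quad W(t)=c_0^{1/p}+c_1^{1/p}t,\quad \sigma^{1/p}(A,B)=\sum_{i=1}^{p-1}\sigma_i^{1/p}A^iB^{p-i}.$$ Say that $f$ is parameterized by $(a,b,c)$ if, after an affine change of the coordinate $t$ of $\mathbb A^1$, $f=[MV^p:MW^p:M\sigma^{1/p}(V,W)-1]$. (1) There are coefficients $a_j,b_i,c_k\in\mathbf k$ parameterizing $f$, with $a_{d-p}=0$ if $d>p$, such that the image $f(\mathbb P^1)$ is precisely the zero locus of $$\Psi=\begin{cases}L_1^d-(-1)^d\pi^p\Delta_X,& d-p=0,\\ L_1^d-(-1)^d\pi^p\Delta_X\,L_0,& d-p=1,\\ L_1^d-(-1)^d\pi^p\Delta_X\cdot L_0\prod_{j=1}^{d-p-1}(L_0-a_j^pL_1),& d-p>1,\end{cases}$$ and, if $\pi\neq0$, $\Psi$ generates the homogeneous ideal of the image with its reduced structure. (2) For any coefficients $a_j,b_i,c_k$ that parameterize $f$, the image of $f$ is the zero locus of $$L_1^d-(-1)^d\pi^p\Delta_X\prod_{j=1}^{d-p}(L_0-a_j^pL_1).$$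 -/

import Mathlib

open Polynomial

noncomputable section

namespace StrangeCurve

/-- The form `σ(A,B) = ∑_{i=1}^{p-1} σ_i A^i B^{p-i}`, evaluated in a `k`-algebra. -/
def sigmaForm {k R : Type*} [Field k] [CommRing R] [Algebra k R] (p : ℕ) (σ : ℕ → k) (A B : R) : R :=
  ∑ i ∈ Finset.Icc 1 (p - 1), σ i • (A ^ i * B ^ (p - i))

/-- The equation `σ(x₀,x₁) - x₂^p` of the boundary `Δ_X ⊂ ℙ²`. -/
def boundaryPoly {k : Type*} [Field k] (p : ℕ) (σ : ℕ → k) : MvPolynomial (Fin 3) k :=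
  sigmaForm p σ (MvPolynomial.X 0) (MvPolynomial.X 1) - MvPolynomial.X 2 ^ p

/-- The closed subset `(F = 0)` of `ℙ²(k)` for a homogeneous polynomial `F`. -/
def projZeros {k : Type*} [Field k] (F : MvPolynomial (Fin 3) k) :
    Set (Projectivization k (Fin 3 → k)) :=
  {P | ∀ (v : Fin 3 → k) (hv : v ≠ 0), Projectivization.mk k v hv = P → MvPolynomial.eval v F = 0}

/-- The value at a point of `ℙ¹ = 𝔸¹ ∪ {∞}` of a triple of binary forms of degree `d`, written as
polynomials of degree `≤ d` in the affine coordinate `t`: at `∞` one reads the coefficients of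
`t ^ d`. -/
def valueAt {k : Type*} [Field k] (d : ℕ) (x : Fin 3 → k[X]) (P : OnePoint k) : Fin 3 → k :=
  P.elim (fun i => (x i).coeff d) (fun t i => (x i).eval t)

/-- A morphism `ℙ¹ → ℙ²` of degree `d` with chosen homogeneous coordinates: three binary forms of
degree `d` without common zero on `ℙ¹`. -/
structure PlaneMap (k : Type*) [Field k] (d : ℕ) where
  coord : Fin 3 → k[X]
  natDegree_le : ∀ i, (coord i).natDegree ≤ d
  valueAt_ne_zero : ∀ P : OnePoint k, valueAt d coord P ≠ 0

namespace PlaneMap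

variable {k : Type*} [Field k] {d : ℕ}

/-- The underlying map on points. -/
def toFun (f : PlaneMap k d) (P : OnePoint k) : Projectivization k (Fin 3 → k) :=
  Projectivization.mk k (valueAt d f.coord P) (f.valueAt_ne_zero P)

/-- The image of `ℙ¹` in `ℙ²`. -/
def image (f : PlaneMap k d) : Set (Projectivization k (Fin 3 → k)) := Set.range f.toFun

/-- The homogeneous ideal of the image (with its reduced structure): all polynomials vanishing on
the affine cone over the image. -/
def imageIdeal (f : PlaneMap k d) : Ideal (MvPolynomial (Fin 3) k) :=
  MvPolynomial.vanishingIdeal k {v | ∃ (P : OnePoint k) (c : k), v = c • valueAt d f.coord P}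

/-- `f` is an `𝔸¹`-curve in `X = (ℙ², Δ_X)`: it is not constant and `f⁻¹(Δ_X)` is exactly the
point `∞`; equivalently, `f` restricts to a non-trivial proper morphism `𝔸¹ → ℙ² ∖ Δ_X`. -/
def IsA1Curve (p : ℕ) (σ : ℕ → k) (f : PlaneMap k d) : Prop :=
  0 < d ∧ ∀ P : OnePoint k, f.toFun P ∈ projZeros (boundaryPoly p σ) ↔ P = OnePoint.infty

/-- The multiplicity of an `𝔸¹`-curve at `str = [0:0:1]`: the degree of the scheme-theoretic
preimage of `str`, that is, the number of `t ∈ 𝔸¹` with `f(t) = str`, each counted with the order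
of vanishing of the maximal ideal of `str` along `f` at `t`. Since `str ∉ Δ_X`, the point `∞`
does not contribute. -/
def multStr (f : PlaneMap k d) : ℕ :=
  Module.finrank k (k[X] ⧸ Ideal.span {f.coord 0, f.coord 1})

/-- The coefficients of the three forms: a point of the affine space of triples of binary forms. -/
def coeffs (f : PlaneMap k d) : Fin 3 × Fin (d + 1) → k := fun ij => (f.coord ij.1).coeff ij.2

end PlaneMap

/-- The stratum `𝒜°_{pd,m}(X)`: the `𝔸¹`-curves of degree `d` (contact order `pd`) of multiplicity
`m` at `str`. -/
def stratum {k : Type*} [Field k] (p : ℕ) (σ : ℕ → k) (d m : ℕ) : Set (PlaneMap k d) :=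
  {f | f.IsA1Curve p σ ∧ f.multStr = m}

/-- The component `𝒜_{pd,m}(X)`: the Zariski closure of `𝒜°_{pd,m}(X)` in the moduli of
`𝔸¹`-curves of degree `d`. The stratum is stable under rescaling the coordinates and under the
automorphisms of `(ℙ¹,∞)`, so the closure may be taken in the space of triples of forms. -/
def component {k : Type*} [Field k] (p : ℕ) (σ : ℕ → k) (d m : ℕ) : Set (PlaneMap k d) :=
  {f | f.IsA1Curve p σ ∧ f.coeffs ∈ MvPolynomial.zeroLocus k
    (MvPolynomial.vanishingIdeal k (PlaneMap.coeffs '' stratum p σ d m))}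

section Parameterization

variable {k : Type*} [Field k]

/-- The `p`-th root in a perfect field of characteristic `p`. -/
def pthRoot (p : ℕ) [ExpChar k p] [PerfectRing k p] (a : k) : k := (frobeniusEquiv k p).symm a

/-- `M(t) = ∏_{j=1}^m (t + a_j)`. -/
def paramM (m : ℕ) (a : ℕ → k) : k[X] := ∏ j ∈ Finset.Icc 1 m, (X + C (a j))

/-- `b₀^{1/p} + b₁^{1/p} t`. -/
def paramV (p : ℕ) [ExpChar k p] [PerfectRing k p] (b : Fin 2 → k) : k[X] :=
  C (pthRoot p (b 0)) + C (pthRoot p (b 1)) * X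

/-- The triple `(M V^p, M W^p, M σ^{1/p}(V,W) - 1)`, where `σ^{1/p}` has the coefficients
`σ_i^{1/p}`. -/
def paramTriple (p : ℕ) [ExpChar k p] [PerfectRing k p] (σ : ℕ → k) (m : ℕ)
    (a : ℕ → k) (b c : Fin 2 → k) : Fin 3 → k[X] :=
  ![paramM m a * paramV p b ^ p,
    paramM m a * paramV p c ^ p,
    paramM m a * sigmaForm p (fun i => pthRoot p (σ i)) (paramV p b) (paramV p c) - 1]

/-- After an affine change `t ↦ rt + s` of the coordinate of `𝔸¹`, the curve `f` is given by the
above triple. -/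
def HasParameterization {d : ℕ} (p : ℕ) [ExpChar k p] [PerfectRing k p] (σ : ℕ → k) (m : ℕ)
    (f : PlaneMap k d) (a : ℕ → k) (b c : Fin 2 → k) : Prop :=
  ∃ r s l : k, r ≠ 0 ∧ l ≠ 0 ∧
    ∀ i, (f.coord i).comp (C r * X + C s) = C l * paramTriple p σ m a b c i

end Parameterization

section Equations

variable {k : Type*} [Field k]

/-- `L_k = c_k x₀ - b_k x₁`. -/
def linForm (b c : Fin 2 → k) (i : Fin 2) : MvPolynomial (Fin 3) k :=
  MvPolynomial.C (c i) * MvPolynomial.X 0 - MvPolynomial.C (b i) * MvPolynomial.X 1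

/-- `π = b₁ c₀ - b₀ c₁`. -/
def piCoeff (b c : Fin 2 → k) : k := b 1 * c 0 - b 0 * c 1

/-- `L₁^d - (-1)^d π^p Δ_X ∏_{j=1}^{d-p} (L₀ - a_j^p L₁)`. -/
def fullEquation (p : ℕ) (σ : ℕ → k) (d : ℕ) (a : ℕ → k) (b c : Fin 2 → k) :
    MvPolynomial (Fin 3) k :=
  linForm b c 1 ^ d - (-1) ^ d * MvPolynomial.C (piCoeff b c ^ p) * boundaryPoly p σ *
    ∏ j ∈ Finset.Icc 1 (d - p), (linForm b c 0 - MvPolynomial.C (a j ^ p) * linForm b c 1)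

/-- The polynomial `Ψ` (for `p ≤ d`). -/
def Psi (p : ℕ) (σ : ℕ → k) (d : ℕ) (a : ℕ → k) (b c : Fin 2 → k) : MvPolynomial (Fin 3) k :=
  if d - p = 0 then
    linForm b c 1 ^ d - (-1) ^ d * MvPolynomial.C (piCoeff b c ^ p) * boundaryPoly p σ
  else if d - p = 1 then
    linForm b c 1 ^ d -
      (-1) ^ d * MvPolynomial.C (piCoeff b c ^ p) * boundaryPoly p σ * linForm b c 0
  else
    linForm b c 1 ^ d -
      (-1) ^ d * MvPolynomial.C (piCoeff b c ^ p) * boundaryPoly p σ * linForm b c 0 *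
        ∏ j ∈ Finset.Icc 1 (d - p - 1), (linForm b c 0 - MvPolynomial.C (a j ^ p) * linForm b c 1)

end Equations

end StrangeCurve

end

/-! On an `𝔸¹`-curve the polynomial `σ(f₀,f₁) - f₂^p` has no zero on `𝔸¹`, hence is a nonzero
constant `κ^p`. Write `f₀ = g u`, `f₁ = g v` with `u`, `v` coprime. Differentiation kills all p-th
powers and leaves `σ(u,v)' = 0`. By Euler's relation for a form of degree `p`, this derivative is a
multiple of the Wronskian of `u`, `v`, and it follows that `u' = v' = 0`, so `u = V^p`, `v = W^p`.
Taking a p-th root gives `f₂ = g σ^{1/p}(V,W) - κ` (`PlaneMap.IsA1Curve.exists_eq`).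

The multiplicity at `str` is `deg g`, so on the stratum `deg g = d - p` and `V`, `W` have degree at
most 1. Two closed conditions pass to the closure: a linear relation between `f₀` and `f₁` with
coefficients in `⟨1, X^p⟩` (vanishing minors), which bounds the degrees of `V` and `W`, and the
vanishing of certain resultants, needed when `V` and `W` are constant, which splits a factor `X^p -
r` off `g`, to be absorbed into `V` and `W` (`exists_eq_of_mem_component`). Scaling, and a
translation moving a root of `g` to 0, give the parameterization.

On the parameterized affine curve `Δ_X = 1`, `L₁ = -πM` and `L₀ - a_j^p L₁ = πM (t + a_j)^p`, which
yields the equation. Conversely, if `π ≠ 0` the parameter is recovered from `t^p = -L₀/L₁`; if `π =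
0` the equation is that of a line, onto which the curve maps (`coneOver_paramTriple`).

For the ideal, the Nullstellensatz reduces the claim to squarefreeness. The equation is `B + A x₂^p`
with `A`, `B` free of `x₂`; a derivation killing `x₂` shows that a repeated factor is free of `x₂`,
so it divides `A` and `B`, hence `L₁` and `L₀`, which is impossible when `π ≠ 0`
(`squarefree_fullEquation`). -/

noncomputable section

namespace StrangeCurve

/-! ### Forms of degree p and p-th roots in characteristic p -/

section SigmaForm

variable {k : Type*} [Field k]

theorem sigmaForm_mul_left {R : Type*} [CommRing R] [Algebra k R] {p : ℕ} (σ : ℕ → k) (g u v : R) :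
    sigmaForm p σ (g * u) (g * v) = g ^ p * sigmaForm p σ u v := by
  unfold sigmaForm
  rw [Finset.mul_sum]
  refine Finset.sum_congr rfl fun i hi => ?_
  have h : i + (p - i) = p := by have := Finset.mem_Icc.1 hi; omega
  rw [mul_smul_comm, mul_pow, mul_pow, ← h, pow_add, Nat.add_sub_cancel_left]
  congr 1
  ring

theorem map_sigmaForm {R S : Type*} [CommRing R] [Algebra k R] [CommRing S] [Algebra k S] {p : ℕ}
    (φ : R →ₐ[k] S) (σ : ℕ → k) (u v : R) :
    φ (sigmaForm p σ u v) = sigmaForm p σ (φ u) (φ v) := by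
  simp [sigmaForm, map_sum, map_mul, map_pow]

variable {p : ℕ} [Fact p.Prime] [CharP k p]

theorem pthRoot_pow [PerfectRing k p] (x : k) : pthRoot p x ^ p = x :=
  frobeniusEquiv_symm_pow_p k p x

theorem sigmaForm_pow [PerfectRing k p] {R : Type*} [CommRing R] [Algebra k R] [CharP R p]
    (σ : ℕ → k) (V W : R) :
    sigmaForm p σ (V ^ p) (W ^ p) = sigmaForm p (fun i => pthRoot p (σ i)) V W ^ p := by
  unfold sigmaForm
  rw [sum_pow_char]
  refine Finset.sum_congr rfl fun i _ => ?_
  rw [_root_.smul_pow, pthRoot_pow, mul_pow, ← pow_mul, ← pow_mul, ← pow_mul,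
    ← pow_mul, mul_comm p, mul_comm p]

end SigmaForm

section PthRoot

variable {k : Type*} [Field k] {p : ℕ} [Fact p.Prime] [CharP k p] [PerfectRing k p]

theorem pthRoot_pow_self (x : k) : pthRoot p (x ^ p) = x :=
  frobeniusEquiv_symm_apply_frobenius k p x

/-- Frobenius is additive and a domain is reduced. Identities involving p-th roots are checked after
raising to the power `p`. -/
theorem pow_char_injective {R : Type*} [CommRing R] [IsDomain R] [CharP R p] {x y : R}
    (h : x ^ p = y ^ p) : x = y := by
  have h1 : (x - y) ^ p = 0 := by rw [sub_pow_char, h, sub_self]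
  exact sub_eq_zero.1 (eq_zero_of_pow_eq_zero h1)

end PthRoot

/-- The cone over the image of a triple of binary forms of degree `d`. -/
def coneOver {k : Type*} [Field k] (d : ℕ) (x : Fin 3 → k[X]) : Set (Fin 3 → k) :=
  {v | ∃ (P : OnePoint k) (c : k), v = c • valueAt d x P}

theorem valueAt_coe {k : Type*} [Field k] (d : ℕ) (x : Fin 3 → k[X]) (t : k) :
    valueAt d x (t : OnePoint k) = fun i => (x i).eval t := rfl

theorem valueAt_infty {k : Type*} [Field k] (d : ℕ) (x : Fin 3 → k[X]) :
    valueAt d x OnePoint.infty = fun i => (x i).coeff d := rfl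

/-! ### Images, affine cones and changes of coordinate -/

section Image

variable {k : Type*} [Field k] {d : ℕ}

theorem image_eq_projZeros (f : PlaneMap k d) (F : MvPolynomial (Fin 3) k)
    (h : coneOver d f.coord = {v | MvPolynomial.eval v F = 0}) : f.image = projZeros F := by
  ext Q
  constructor
  · rintro ⟨P, rfl⟩ v hv hvP
    obtain ⟨c, hc⟩ := (Projectivization.mk_eq_mk_iff' k _ _ _ _).1 hvP
    have : v ∈ coneOver d f.coord := ⟨P, c, hc.symm⟩
    rwa [h] at this
  · intro hQ
    induction Q using Projectivization.ind with
    | h v hv =>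
      have : v ∈ coneOver d f.coord := by rw [h]; exact hQ v hv rfl
      obtain ⟨P, c, hc⟩ := this
      exact ⟨P, ((Projectivization.mk_eq_mk_iff' k _ _ _ _).2 ⟨c, hc.symm⟩).symm⟩

theorem coeff_comp_linear {x : k[X]} (hx : x.natDegree ≤ d) (r s : k) (hr : r ≠ 0) :
    (x.comp (C r * X + C s)).coeff d = r ^ d * x.coeff d := by
  have h1 : (C r * X + C s : k[X]).natDegree = 1 := natDegree_linear hr
  rcases hx.lt_or_eq with h | h
  · rw [coeff_eq_zero_of_natDegree_lt h, coeff_eq_zero_of_natDegree_lt, mul_zero]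
    rw [natDegree_comp, h1, mul_one]
    exact h
  · have h2 := coeff_comp_degree_mul_degree (p := x) (q := C r * X + C s) (by rw [h1]; simp)
    rw [h1, mul_one, h] at h2
    rw [h2, leadingCoeff_linear hr, mul_comm, leadingCoeff, h]

/-- Reparameterizing by an affine change of coordinate and rescaling does not change the cone. -/
theorem coneOver_eq_of_comp {x y : Fin 3 → k[X]} (hx : ∀ i, (x i).natDegree ≤ d) {r s l : k}
    (hr : r ≠ 0) (hl : l ≠ 0) (h : ∀ i, (x i).comp (C r * X + C s) = C l * y i) :
    coneOver d x = coneOver d y ∧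
      ((∀ P, valueAt d x P ≠ 0) → ∀ P, valueAt d y P ≠ 0) := by
  have hinf : r ^ d • valueAt d x OnePoint.infty = l • valueAt d y OnePoint.infty := by
    ext i
    have := congrArg (fun q => coeff q d) (h i)
    simp only [coeff_comp_linear (hx i) r s hr, coeff_C_mul] at this
    simpa [valueAt_infty] using this
  have hfin (t : k) : valueAt d x ((r * t + s : k) : OnePoint k) =
      l • valueAt d y (t : OnePoint k) := by
    ext i
    have := congrArg (eval t) (h i)
    simpa [valueAt_coe, eval_comp] using this
  have hrd : r ^ d ≠ 0 := pow_ne_zero _ hr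
  have hinf' : valueAt d x OnePoint.infty = ((r ^ d)⁻¹ * l) • valueAt d y OnePoint.infty := by
    rw [mul_smul, ← hinf, smul_smul, inv_mul_cancel₀ hrd, one_smul]
  have hinf'' : valueAt d y OnePoint.infty = (l⁻¹ * r ^ d) • valueAt d x OnePoint.infty := by
    rw [mul_smul, hinf, smul_smul, inv_mul_cancel₀ hl, one_smul]
  have hfin' (t : k) : valueAt d y (t : OnePoint k) =
      l⁻¹ • valueAt d x ((r * t + s : k) : OnePoint k) := by
    rw [hfin, smul_smul, inv_mul_cancel₀ hl, one_smul]
  refine ⟨Set.Subset.antisymm ?_ ?_, ?_⟩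
  · rintro v ⟨P, c, rfl⟩
    induction P using OnePoint.rec with
    | infty => exact ⟨OnePoint.infty, _, by rw [hinf', smul_smul]⟩
    | coe t =>
      refine ⟨((r⁻¹ * (t - s) : k) : OnePoint k), c * l, ?_⟩
      rw [mul_smul, ← hfin]
      congr 4
      field_simp
      ring
  · rintro v ⟨P, c, rfl⟩
    induction P using OnePoint.rec with
    | infty => exact ⟨OnePoint.infty, _, by rw [hinf'', smul_smul]⟩
    | coe t => exact ⟨_, _, by rw [hfin', smul_smul]⟩
  · intro hx0 P hP
    induction P using OnePoint.rec with
    | infty => exact hx0 OnePoint.infty (by rw [hinf', hP, smul_zero])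
    | coe t => exact hx0 _ (by rw [hfin, hP, smul_zero])

end Image

/-! ### Homogeneity of the equation and degrees of σ(V,W) -/

section Equation

variable {k : Type*} [Field k]

theorem eval_sigmaForm {p : ℕ} (σ : ℕ → k) (v : Fin 3 → k) (F G : MvPolynomial (Fin 3) k) :
    MvPolynomial.eval v (sigmaForm p σ F G) =
      sigmaForm p σ (MvPolynomial.eval v F) (MvPolynomial.eval v G) := by
  simp only [← MvPolynomial.coe_aeval_eq_eval]
  exact map_sigmaForm (MvPolynomial.aeval v) σ F G

theorem eval_fullEquation (p : ℕ) (σ : ℕ → k) (d : ℕ) (a : ℕ → k) (b c : Fin 2 → k)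
    (v : Fin 3 → k) :
    MvPolynomial.eval v (fullEquation p σ d a b c) =
      (c 1 * v 0 - b 1 * v 1) ^ d - (-1) ^ d * piCoeff b c ^ p *
        (sigmaForm p σ (v 0) (v 1) - v 2 ^ p) *
        ∏ j ∈ Finset.Icc 1 (d - p),
          ((c 0 * v 0 - b 0 * v 1) - a j ^ p * (c 1 * v 0 - b 1 * v 1)) := by
  simp [fullEquation, linForm, boundaryPoly, eval_sigmaForm, map_prod]

theorem eval_smul_fullEquation {p d : ℕ} (hd : p ≤ d) (σ : ℕ → k) (a : ℕ → k) (b c : Fin 2 → k)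
    (u : k) (v : Fin 3 → k) :
    MvPolynomial.eval (u • v) (fullEquation p σ d a b c) =
      u ^ d * MvPolynomial.eval v (fullEquation p σ d a b c) := by
  obtain ⟨m, rfl⟩ := Nat.exists_eq_add_of_le hd
  have h (x : k) : c 0 * (u * v 0) - b 0 * (u * v 1) - x * (c 1 * (u * v 0) - b 1 * (u * v 1)) =
      u * (c 0 * v 0 - b 0 * v 1 - x * (c 1 * v 0 - b 1 * v 1)) := by ring
  simp only [eval_fullEquation, Pi.smul_apply, smul_eq_mul, sigmaForm_mul_left, h,
    Finset.prod_mul_distrib, Finset.prod_const, Nat.card_Icc, Nat.add_sub_cancel_left,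
    Nat.add_sub_cancel]
  rw [show c 1 * (u * v 0) - b 1 * (u * v 1) = u * (c 1 * v 0 - b 1 * v 1) by ring, mul_pow,
    mul_pow, pow_add u p m]
  ring

theorem natDegree_sigmaForm_le {p : ℕ} (σ : ℕ → k) {V W : k[X]} (hV : V.natDegree ≤ 1)
    (hW : W.natDegree ≤ 1) : (sigmaForm p σ V W).natDegree ≤ p := by
  refine natDegree_sum_le_of_forall_le _ _ fun i hi => ?_
  refine (natDegree_smul_le _ _).trans (natDegree_mul_le.trans ?_)
  have h1 := natDegree_pow_le_of_le i hV
  have h2 := natDegree_pow_le_of_le (p - i) hW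
  have := Finset.mem_Icc.1 hi
  omega

theorem coeff_sigmaForm {p : ℕ} (σ : ℕ → k) {V W : k[X]} (hV : V.natDegree ≤ 1)
    (hW : W.natDegree ≤ 1) :
    (sigmaForm p σ V W).coeff p = sigmaForm p σ (V.coeff 1) (W.coeff 1) := by
  simp only [sigmaForm, finsetSum_coeff, coeff_smul]
  refine Finset.sum_congr rfl fun i hi => ?_
  congr 1
  have e : p = i * 1 + (p - i) * 1 := by have := Finset.mem_Icc.1 hi; omega
  generalize p - i = n at *
  rw [e, coeff_mul_add_eq_of_natDegree_le (natDegree_pow_le_of_le i hV)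
    (natDegree_pow_le_of_le n hW), coeff_pow_of_natDegree_le hV, coeff_pow_of_natDegree_le hW]

end Equation

/-! ### Values of the normal form on the affine line and at infinity -/

section Parameter

variable {k : Type*} [Field k] {p : ℕ} [Fact p.Prime] [CharP k p] [PerfectRing k p]

theorem paramM_monic (m : ℕ) (a : ℕ → k) : (paramM m a).Monic :=
  monic_prod_of_monic _ _ fun _ _ => monic_X_add_C _

theorem natDegree_paramM (m : ℕ) (a : ℕ → k) : (paramM m a).natDegree = m := by
  rw [paramM, natDegree_prod_of_monic _ _ fun _ _ => monic_X_add_C _]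
  simp

theorem eval_paramM (m : ℕ) (a : ℕ → k) (t : k) :
    (paramM m a).eval t = ∏ j ∈ Finset.Icc 1 m, (t + a j) := by
  simp [paramM, eval_prod]

theorem paramV_pow (b : Fin 2 → k) : paramV p b ^ p = C (b 0) + C (b 1) * X ^ p := by
  rw [paramV, add_pow_char, mul_pow, ← C_pow, ← C_pow, pthRoot_pow, pthRoot_pow]

theorem natDegree_paramV_le (b : Fin 2 → k) : (paramV p b).natDegree ≤ 1 := by
  rw [paramV]; compute_degree

theorem coeff_paramV_one (b : Fin 2 → k) : (paramV p b).coeff 1 = pthRoot p (b 1) := by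
  simp [paramV]

theorem valueAt_paramTriple_coe (σ : ℕ → k) (d m : ℕ) (a : ℕ → k) (b c : Fin 2 → k) (t : k) :
    valueAt d (paramTriple p σ m a b c) (t : OnePoint k) =
      ![(paramM m a).eval t * (b 0 + b 1 * t ^ p), (paramM m a).eval t * (c 0 + c 1 * t ^ p),
        (paramM m a).eval t * pthRoot p (sigmaForm p σ (b 0 + b 1 * t ^ p) (c 0 + c 1 * t ^ p))
          - 1] := by
  rw [valueAt_coe]
  ext i
  have hV (b : Fin 2 → k) : b 0 + b 1 * t ^ p = ((paramV p b).eval t) ^ p := by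
    rw [← eval_pow, paramV_pow]; simp
  fin_cases i
  · simp [paramTriple, hV]
  · simp [paramTriple, hV]
  · simp only [paramTriple, hV, sigmaForm_pow, pthRoot_pow_self]
    simp [sigmaForm, eval_finsetSum]

theorem valueAt_paramTriple_infty (σ : ℕ → k) (m : ℕ) (a : ℕ → k) (b c : Fin 2 → k) :
    valueAt (m + p) (paramTriple p σ m a b c) OnePoint.infty =
      ![b 1, c 1, pthRoot p (sigmaForm p σ (b 1) (c 1))] := by
  have hp : 0 < p := (Fact.out : p.Prime).pos
  have hM : (paramM m a).coeff m = 1 := by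
    simpa [natDegree_paramM] using (paramM_monic m a).coeff_natDegree
  have hV (b : Fin 2 → k) : (paramM m a * paramV p b ^ p).coeff (m + p) = b 1 := by
    rw [coeff_mul_add_eq_of_natDegree_le (natDegree_paramM m a).le
      (by simpa using natDegree_pow_le_of_le p (natDegree_paramV_le b)), hM, paramV_pow]
    simp [coeff_C, hp.ne']
  rw [valueAt_infty]
  ext i
  fin_cases i
  · simpa [paramTriple] using hV b
  · simpa [paramTriple] using hV c
  · simp only [paramTriple]
    change coeff (paramM m a * sigmaForm p _ _ _ - 1) _ = pthRoot p _
    rw [coeff_sub, coeff_mul_add_eq_of_natDegree_le (natDegree_paramM m a).le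
      (natDegree_sigmaForm_le _ (natDegree_paramV_le b) (natDegree_paramV_le c)), hM,
      coeff_sigmaForm _ (natDegree_paramV_le b) (natDegree_paramV_le c), coeff_paramV_one,
      coeff_paramV_one, one_mul, coeff_one, if_neg (by omega), sub_zero]
    apply pow_char_injective (p := p)
    rw [← sigmaForm_pow, pthRoot_pow, pthRoot_pow, pthRoot_pow]

end Parameter

/-! ### The cone over a normal form as a zero locus -/

section Cone

variable {k : Type*} [Field k] {p : ℕ} [Fact p.Prime] [CharP k p]

/-- A curve of the normal form lies on the zero locus of its full equation. -/
theorem fullEquation_vanishes [PerfectRing k p] (σ : ℕ → k) (m : ℕ) (a : ℕ → k)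
    (b c : Fin 2 → k) (P : OnePoint k) :
    MvPolynomial.eval (valueAt (m + p) (paramTriple p σ m a b c) P)
      (fullEquation p σ (m + p) a b c) = 0 := by
  have hp : p ≠ 0 := (Fact.out : p.Prime).ne_zero
  rw [eval_fullEquation, Nat.add_sub_cancel]
  induction P using OnePoint.rec with
  | infty =>
    rw [valueAt_paramTriple_infty]
    simp only [Matrix.cons_val, pthRoot_pow]
    rw [mul_comm (c 1), sub_self, sub_self, zero_pow (by omega)]
    ring
  | coe t =>
    rw [valueAt_paramTriple_coe]
    -- The factor `Δ_X` becomes 1 here: the p-th power of `M σ^{1/p}(V,W) - 1` is `σ(MV^p, MW^p) -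
    -- 1`.
    simp only [Matrix.cons_val, sigmaForm_mul_left, sub_pow_char, mul_pow, pthRoot_pow, one_pow,
      sub_sub_cancel]
    set M := (paramM m a).eval t with hM
    have h1 : c 1 * (M * (b 0 + b 1 * t ^ p)) - b 1 * (M * (c 0 + c 1 * t ^ p)) =
        (-1) * (piCoeff b c * M) := by rw [piCoeff]; ring
    have h2 (j : ℕ) : c 0 * (M * (b 0 + b 1 * t ^ p)) - b 0 * (M * (c 0 + c 1 * t ^ p)) -
        a j ^ p * ((-1) * (piCoeff b c * M)) = piCoeff b c * M * (t + a j) ^ p := by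
      rw [add_pow_char, piCoeff]; ring
    rw [h1]
    simp only [h2, Finset.prod_mul_distrib, Finset.prod_const, Finset.prod_pow, Nat.card_Icc,
      Nat.add_sub_cancel, ← eval_paramM]
    rw [← hM]
    ring

variable [IsAlgClosed k]

/-- As `π ≠ 0`, the forms `L₀`, `L₁` can replace `x₀`, `x₁` as coordinates. Where `L₁ ≠ 0` the
parameter is the p-th root of `-L₀/L₁`; where `L₁ = 0` the point is the image of `∞` or lies over
`str`. -/
theorem mem_coneOver_of_piCoeff_ne_zero (σ : ℕ → k) (m : ℕ) (a : ℕ → k)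
    (b c : Fin 2 → k) (hπ : piCoeff b c ≠ 0) (v : Fin 3 → k)
    (hv : MvPolynomial.eval v (fullEquation p σ (m + p) a b c) = 0) :
    v ∈ coneOver (m + p) (paramTriple p σ m a b c) := by
  have hp : p ≠ 0 := (Fact.out : p.Prime).ne_zero
  set L0 := c 0 * v 0 - b 0 * v 1 with hL0
  set L1 := c 1 * v 0 - b 1 * v 1 with hL1
  have hv0 : piCoeff b c * v 0 = b 1 * L0 - b 0 * L1 := by rw [hL0, hL1, piCoeff]; ring
  have hv1 : piCoeff b c * v 1 = c 1 * L0 - c 0 * L1 := by rw [hL0, hL1, piCoeff]; ring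
  by_cases h1 : L1 = 0
  · rw [h1] at hv0 hv1
    rw [eval_fullEquation, ← hL0, ← hL1, h1, zero_pow (by omega), zero_sub, neg_eq_zero,
      Nat.add_sub_cancel] at hv
    simp only [mul_zero, sub_zero, Finset.prod_const, Nat.card_Icc, Nat.add_sub_cancel] at hv
    have hs : (-1 : k) ^ (m + p) * piCoeff b c ^ p ≠ 0 :=
      mul_ne_zero (pow_ne_zero _ (neg_ne_zero.2 one_ne_zero)) (pow_ne_zero _ hπ)
    have hw0 : v 0 = L0 / piCoeff b c * b 1 := by
      field_simp; linear_combination hv0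
    have hw1 : v 1 = L0 / piCoeff b c * c 1 := by
      field_simp; linear_combination hv1
    by_cases hΔ : sigmaForm p σ (v 0) (v 1) - v 2 ^ p = 0
    · refine ⟨OnePoint.infty, L0 / piCoeff b c, ?_⟩
      rw [valueAt_paramTriple_infty]
      ext i
      fin_cases i
      · exact hw0
      · exact hw1
      · apply pow_char_injective (p := p)
        change v 2 ^ p = (L0 / piCoeff b c * pthRoot p _) ^ p
        rw [mul_pow, pthRoot_pow, ← sigmaForm_mul_left, ← hw0, ← hw1]
        exact (sub_eq_zero.1 hΔ).symm
    · have hL0m : L0 ^ m = 0 := by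
        rcases mul_eq_zero.1 hv with h | h
        · exact absurd h (mul_ne_zero hs hΔ)
        · exact h
      have hm : m ≠ 0 := by rintro rfl; simp at hL0m
      have h0 : L0 = 0 := eq_zero_of_pow_eq_zero hL0m
      -- Here `v = (0, 0, v₂)` lies over `str`, which the curve meets at the roots of `M`; one
      -- exists since `m ≠ 0`.
      refine ⟨((-a 1 : k) : OnePoint k), -v 2, ?_⟩
      have hM : (paramM m a).eval (-a 1) = 0 := by
        rw [eval_paramM]
        exact Finset.prod_eq_zero (i := 1) (Finset.mem_Icc.2 ⟨le_rfl, by omega⟩) (by ring)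
      rw [valueAt_paramTriple_coe, hM]
      rw [h0] at hw0 hw1
      ext i
      fin_cases i
      · simpa using hw0
      · simpa using hw1
      · simp
  · obtain ⟨t, ht⟩ : ∃ t : k, t ^ p = -L0 / L1 := ⟨pthRoot p (-L0 / L1), pthRoot_pow _⟩
    have hL0t : L0 = - (L1 * t ^ p) := by rw [ht]; field_simp
    set M := (paramM m a).eval t with hM
    have key : L1 ^ (m + p) = (-1) ^ (m + p) * piCoeff b c ^ p *
        (sigmaForm p σ (v 0) (v 1) - v 2 ^ p) * ((-L1) ^ m * M ^ p) := by
      have h2 (j : ℕ) : L0 - a j ^ p * L1 = -L1 * (t + a j) ^ p := by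
        rw [add_pow_char, hL0t]; ring
      rw [eval_fullEquation, ← hL0, ← hL1, Nat.add_sub_cancel] at hv
      simp only [h2, Finset.prod_mul_distrib, Finset.prod_const, Finset.prod_pow, Nat.card_Icc,
        Nat.add_sub_cancel, ← eval_paramM] at hv
      exact sub_eq_zero.1 hv
    have hM0 : M ≠ 0 := by
      intro h
      rw [h, zero_pow hp, mul_zero, mul_zero] at key
      exact h1 (eq_zero_of_pow_eq_zero key)
    -- On the curve `L₁` takes the value `-πM` at `t`, which forces the scalar. What remains of the
    -- equation is `Δ_X(v) = u^p`, and this determines `v₂`.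
    set u := L1 / (-(piCoeff b c * M)) with hu
    have hu0 : u ≠ 0 := div_ne_zero h1 (neg_ne_zero.2 (mul_ne_zero hπ hM0))
    have hL1u : L1 = -(u * (piCoeff b c * M)) := by rw [hu]; field_simp
    have hw0 : v 0 = u * (M * (b 0 + b 1 * t ^ p)) := by
      apply mul_left_cancel₀ hπ
      rw [hv0, hL0t, hL1u]; ring
    have hw1 : v 1 = u * (M * (c 0 + c 1 * t ^ p)) := by
      apply mul_left_cancel₀ hπ
      rw [hv1, hL0t, hL1u]; ring
    have hΔ : sigmaForm p σ (v 0) (v 1) - v 2 ^ p = u ^ p := by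
      have hne : L1 ^ m * (piCoeff b c * M) ^ p ≠ 0 :=
        mul_ne_zero (pow_ne_zero _ h1) (pow_ne_zero _ (mul_ne_zero hπ hM0))
      apply mul_left_cancel₀ hne
      have hL1p : L1 ^ p = (-1) ^ p * (u ^ p * (piCoeff b c * M) ^ p) := by
        conv_lhs => rw [hL1u]
        rw [neg_pow, mul_pow]
      have e2 : (-1 : k) ^ p * (-1) ^ p = 1 := by rw [← mul_pow]; simp
      have e3 : (-1 : k) ^ m * (-1) ^ m = 1 := by rw [← mul_pow]; simp
      rw [pow_add, hL1p, neg_pow L1, pow_add] at key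
      linear_combination (-(-1) ^ p) * key + L1 ^ m * (piCoeff b c * M) ^ p * u ^ p * e2
        - (L1 ^ m * (piCoeff b c * M) ^ p * (sigmaForm p σ (v 0) (v 1) - v 2 ^ p)) *
          ((-1) ^ p * (-1) ^ p * e3 + e2)
    refine ⟨(t : OnePoint k), u, ?_⟩
    rw [valueAt_paramTriple_coe, ← hM]
    ext i
    fin_cases i
    · exact hw0
    · exact hw1
    · apply pow_char_injective (p := p)
      change v 2 ^ p = (u * (M * pthRoot p _ - 1)) ^ p
      rw [mul_pow, sub_pow_char, mul_pow, pthRoot_pow, one_pow]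
      rw [hw0, hw1, sigmaForm_mul_left, sigmaForm_mul_left] at hΔ
      linear_combination -hΔ

/-- For `π = 0` the equation reduces to `L₁^d = 0`. The first two coordinates are proportional to
`(b₁, c₁)`, so the curve lies on this line, and its affine coordinate is a polynomial of degree `m +
p > 0`, hence surjective. -/
theorem mem_coneOver_of_piCoeff_eq_zero (σ : ℕ → k) (m : ℕ) (a : ℕ → k)
    (b c : Fin 2 → k) (hπ : piCoeff b c = 0) (hbc : b 1 ≠ 0 ∨ c 1 ≠ 0) (v : Fin 3 → k)
    (hv : MvPolynomial.eval v (fullEquation p σ (m + p) a b c) = 0) :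
    v ∈ coneOver (m + p) (paramTriple p σ m a b c) := by
  have hp : p ≠ 0 := (Fact.out : p.Prime).ne_zero
  rw [eval_fullEquation, hπ, zero_pow hp] at hv
  have hL1 : c 1 * v 0 - b 1 * v 1 = 0 := eq_zero_of_pow_eq_zero (n := m + p) (by simpa using hv)
  obtain ⟨l, hl0, hl1⟩ : ∃ l, v 0 = l * b 1 ∧ v 1 = l * c 1 := by
    rcases hbc with h | h
    · exact ⟨v 0 / b 1, by field_simp, by field_simp; linear_combination -hL1⟩
    · exact ⟨v 1 / c 1, by field_simp; linear_combination hL1, by field_simp⟩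
  obtain ⟨μ, hμ0, hμ1⟩ : ∃ μ, b 0 = μ * b 1 ∧ c 0 = μ * c 1 := by
    rw [piCoeff] at hπ
    rcases hbc with h | h
    · exact ⟨b 0 / b 1, by field_simp, by field_simp; linear_combination hπ⟩
    · exact ⟨c 0 / c 1, by field_simp; linear_combination -hπ, by field_simp⟩
  set τ := pthRoot p (sigmaForm p σ (b 1) (c 1)) with hτ
  have hval (t : k) : valueAt (m + p) (paramTriple p σ m a b c) (t : OnePoint k) =
      ![(paramM m a * (X ^ p + C μ)).eval t * b 1, (paramM m a * (X ^ p + C μ)).eval t * c 1,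
        (paramM m a * (X ^ p + C μ)).eval t * τ - 1] := by
    rw [valueAt_paramTriple_coe]
    have e (x : k) : μ * x + x * t ^ p = (t ^ p + μ) * x := by ring
    rw [hμ0, hμ1, e, e, sigmaForm_mul_left]
    have : pthRoot p ((t ^ p + μ) ^ p * sigmaForm p σ (b 1) (c 1)) = (t ^ p + μ) * τ := by
      apply pow_char_injective (p := p)
      rw [pthRoot_pow, mul_pow, hτ, pthRoot_pow]
    rw [this]
    simp [mul_assoc]
  by_cases hx : v 2 - l * τ = 0
  · refine ⟨OnePoint.infty, l, ?_⟩
    rw [valueAt_paramTriple_infty]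
    ext i
    fin_cases i
    · exact hl0
    · exact hl1
    · exact sub_eq_zero.1 hx
  -- With `q` the value of this polynomial and `s` the scalar, the conditions are `s q = l` and `s
  -- (qτ - 1) = v₂`; hence `s = -(v₂ - lτ)` and `q = l / s`.
  · obtain ⟨t, ht⟩ : ∃ t, (paramM m a * (X ^ p + C μ)).eval t = -l / (v 2 - l * τ) := by
      have hdeg : (paramM m a * (X ^ p + C μ)).natDegree = m + p := by
        rw [(paramM_monic m a).natDegree_mul (monic_X_pow_add_C _ hp), natDegree_paramM,
          natDegree_X_pow_add_C]
      obtain ⟨t, ht⟩ := IsAlgClosed.exists_root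
        (paramM m a * (X ^ p + C μ) - C (-l / (v 2 - l * τ))) (by
          intro h
          have := natDegree_eq_zero_iff_degree_le_zero.2 h.le
          rw [natDegree_sub_C, hdeg] at this
          omega)
      refine ⟨t, ?_⟩
      rw [IsRoot, eval_sub, eval_C] at ht
      exact sub_eq_zero.1 ht
    refine ⟨(t : OnePoint k), -(v 2 - l * τ), ?_⟩
    rw [hval, ht]
    ext i
    fin_cases i
    · simp [hl0]; field_simp; ring
    · simp [hl1]; field_simp; ring
    · simp; field_simp; ring

/-- The affine cone over a curve in normal form is the zero locus of its full equation. -/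
theorem coneOver_paramTriple (σ : ℕ → k) (m : ℕ) (a : ℕ → k) (b c : Fin 2 → k)
    (h : valueAt (m + p) (paramTriple p σ m a b c) OnePoint.infty ≠ 0) :
    coneOver (m + p) (paramTriple p σ m a b c) =
      {v | MvPolynomial.eval v (fullEquation p σ (m + p) a b c) = 0} := by
  have hp : p ≠ 0 := (Fact.out : p.Prime).ne_zero
  apply Set.Subset.antisymm
  · rintro v ⟨P, u, rfl⟩
    change MvPolynomial.eval _ _ = 0
    rw [eval_smul_fullEquation (by omega), fullEquation_vanishes, mul_zero]
  · intro v hv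
    by_cases hπ : piCoeff b c = 0
    · refine mem_coneOver_of_piCoeff_eq_zero σ m a b c hπ ?_ v hv
      by_contra! hbc
      apply h
      rw [valueAt_paramTriple_infty, hbc.1, hbc.2]
      have : pthRoot p (sigmaForm p σ 0 0) = (0 : k) := by
        apply pow_char_injective (p := p)
        have := sigmaForm_mul_left (p := p) σ (0 : k) 0 0
        rw [pthRoot_pow, zero_pow hp]
        simpa [hp] using this
      rw [this]
      ext i
      fin_cases i <;> rfl
    · exact mem_coneOver_of_piCoeff_ne_zero σ m a b c hπ v hv

theorem HasParameterization.coneOver_eq {σ : ℕ → k} {d : ℕ} (hd : p ≤ d) {f : PlaneMap k d}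
    {a : ℕ → k} {b c : Fin 2 → k} (h : HasParameterization p σ (d - p) f a b c) :
    coneOver d f.coord = {v | MvPolynomial.eval v (fullEquation p σ d a b c) = 0} := by
  obtain ⟨m, rfl⟩ : ∃ m, d = m + p := ⟨d - p, by omega⟩
  rw [Nat.add_sub_cancel] at h
  obtain ⟨r, s, l, hr, hl, h⟩ := h
  obtain ⟨h1, h2⟩ := coneOver_eq_of_comp f.natDegree_le hr hl h
  rw [h1, coneOver_paramTriple _ _ _ _ _ (h2 f.valueAt_ne_zero _)]

end Cone

/-! ### The shape of 𝔸¹-curves: Wronskian and p-th powers -/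

section Structure

variable {k : Type*} [Field k] {p : ℕ} [CharP k p]

/-- Euler's relation `A σ_A + B σ_B = pσ = 0` makes `(σ_A, σ_B)` a multiple of `(B, -A)`, so the
chain rule produces the Wronskian. -/
theorem derivative_sigmaForm (σ : ℕ → k) (u v : k[X]) :
    derivative (sigmaForm p σ u v) =
      (∑ i ∈ Finset.Icc 1 (p - 1), C (i * σ i) * (u ^ (i - 1) * v ^ (p - 1 - i))) *
        (derivative u * v - u * derivative v) := by
  unfold sigmaForm
  rw [derivative_sum, Finset.sum_mul]
  refine Finset.sum_congr rfl fun i hi => ?_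
  obtain ⟨j, rfl⟩ : ∃ j, i = j + 1 := ⟨i - 1, by have := Finset.mem_Icc.1 hi; omega⟩
  obtain ⟨n, hn⟩ : ∃ n, p = j + 1 + (n + 1) :=
    ⟨p - (j + 1) - 1, by have := Finset.mem_Icc.1 hi; omega⟩
  have e1 : p - (j + 1) = n + 1 := by omega
  have e2 : p - 1 - (j + 1) = n := by omega
  -- Modulo `p`, the exponents `i` and `p - i` are opposite.
  have hc : (C ((n + 1 : ℕ) : k) : k[X]) = - C ((j + 1 : ℕ) : k) := by
    have : ((p : ℕ) : k) = 0 := CharP.cast_eq_zero k p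
    rw [hn, Nat.cast_add] at this
    rw [← C_neg]
    exact congrArg C (by linear_combination this)
  rw [e1, e2, derivative_smul, derivative_mul, derivative_pow, derivative_pow, hc, smul_eq_C_mul,
    C_mul]
  simp only [Nat.add_sub_cancel]
  ring

variable [Fact p.Prime]

/-- One of the two factors vanishes. If it is the first, the nonzero extreme coefficients give `u ∣
v^(p-2)` and `v ∣ u^(p-2)`, so `u`, `v` are constants. If the Wronskian vanishes, coprimality gives
`u ∣ u'` and `v ∣ v'`, which is impossible by degree unless the derivatives are zero. -/
theorem derivative_eq_zero_of_isCoprime {σ : ℕ → k} (hσ_one : σ 1 = 1) (hσ_last : σ (p - 1) = 1)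
    {u v : k[X]} (huv : IsCoprime u v) (h : derivative (sigmaForm p σ u v) = 0) :
    derivative u = 0 ∧ derivative v = 0 := by
  have hp : 2 ≤ p := (Fact.out : p.Prime).two_le
  rw [derivative_sigmaForm, mul_eq_zero] at h
  rcases h with h | h
  · have hu : IsUnit u := by
      have h1 : (1 : ℕ) ∈ Finset.Icc 1 (p - 1) := Finset.mem_Icc.2 ⟨le_rfl, by omega⟩
      rw [← Finset.add_sum_erase _ _ h1] at h
      have h2 : u ∣ ∑ i ∈ (Finset.Icc 1 (p - 1)).erase 1,
          C (i * σ i) * (u ^ (i - 1) * v ^ (p - 1 - i)) := by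
        refine Finset.dvd_sum fun i hi => ?_
        have := Finset.mem_Icc.1 (Finset.mem_of_mem_erase hi)
        have := Finset.ne_of_mem_erase hi
        exact ((dvd_pow_self u (by omega)).mul_right _).mul_left _
      have h3 := (dvd_add_left h2).1 (h ▸ dvd_zero u)
      simp only [Nat.cast_one, hσ_one, mul_one, C_1, one_mul, Nat.sub_self, pow_zero] at h3
      exact (huv.pow_right.isUnit_of_dvd' dvd_rfl h3)
    have hv : IsUnit v := by
      have h1 : p - 1 ∈ Finset.Icc 1 (p - 1) := Finset.mem_Icc.2 ⟨by omega, le_rfl⟩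
      rw [← Finset.add_sum_erase _ _ h1] at h
      have h2 : v ∣ ∑ i ∈ (Finset.Icc 1 (p - 1)).erase (p - 1),
          C (i * σ i) * (u ^ (i - 1) * v ^ (p - 1 - i)) := by
        refine Finset.dvd_sum fun i hi => ?_
        have := Finset.mem_Icc.1 (Finset.mem_of_mem_erase hi)
        have := Finset.ne_of_mem_erase hi
        exact ((dvd_pow_self v (by omega)).mul_left _).mul_left _
      have h3 := (dvd_add_left h2).1 (h ▸ dvd_zero v)
      have hne : ((p - 1 : ℕ) : k) ≠ 0 := by
        rw [Ne, CharP.cast_eq_zero_iff k p]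
        intro hdvd
        have := Nat.le_of_dvd (by omega) hdvd
        omega
      rw [hσ_last, mul_one, Nat.sub_self, pow_zero, mul_one] at h3
      have h4 := (IsUnit.dvd_mul_left (isUnit_C.2 hne.isUnit)).1 h3
      exact huv.symm.pow_right.isUnit_of_dvd' dvd_rfl h4
    obtain ⟨x, _, rfl⟩ := isUnit_iff.1 hu
    obtain ⟨y, _, rfl⟩ := isUnit_iff.1 hv
    simp
  · have h' : derivative u * v = u * derivative v := sub_eq_zero.1 h
    refine ⟨?_, ?_⟩
    · have : u ∣ derivative u := huv.dvd_of_dvd_mul_right (h' ▸ dvd_mul_right _ _)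
      by_contra hne
      have hd := natDegree_le_of_dvd this hne
      have hu0 : u.natDegree ≠ 0 := fun h0 => hne (by
        rw [eq_C_of_natDegree_eq_zero h0, derivative_C])
      exact absurd hd (not_le.2 (natDegree_derivative_lt hu0))
    · have : v ∣ derivative v := huv.symm.dvd_of_dvd_mul_left (h' ▸ dvd_mul_left _ _)
      by_contra hne
      have hd := natDegree_le_of_dvd this hne
      have hv0 : v.natDegree ≠ 0 := fun h0 => hne (by
        rw [eq_C_of_natDegree_eq_zero h0, derivative_C])
      exact absurd hd (not_le.2 (natDegree_derivative_lt hv0))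

theorem exists_eq_pow_of_derivative_eq_zero [PerfectRing k p] {u : k[X]} (h : derivative u = 0) :
    ∃ V, u = V ^ p := by
  refine ⟨(contract p u).map (frobeniusEquiv k p).symm.toRingHom, ?_⟩
  rw [← map_frobenius_expand, ← map_expand, expand_contract p h (Fact.out : p.Prime).ne_zero,
    Polynomial.map_map]
  conv_lhs => rw [← Polynomial.map_id (p := u)]
  congr 1
  ext x
  exact (frobeniusEquiv_symm_pow_p k p x).symm

/-- `𝔸¹`-curves are given by triples `(g V^p, g W^p, g σ^{1/p}(V, W) - κ)`. -/
theorem PlaneMap.IsA1Curve.exists_eq [IsAlgClosed k] {σ : ℕ → k} (hσ_one : σ 1 = 1)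
    (hσ_last : σ (p - 1) = 1) {d : ℕ} {f : PlaneMap k d} (hf : f.IsA1Curve p σ) :
    ∃ (g V W : k[X]) (κ : k), g ≠ 0 ∧ κ ≠ 0 ∧ IsCoprime V W ∧
      f.coord 0 = g * V ^ p ∧ f.coord 1 = g * W ^ p ∧
      f.coord 2 = g * sigmaForm p (fun i => pthRoot p (σ i)) V W - C κ := by
  have hp : p ≠ 0 := (Fact.out : p.Prime).ne_zero
  obtain ⟨hd, hf⟩ := hf
  set E : k[X] := sigmaForm p σ (f.coord 0) (f.coord 1) - f.coord 2 ^ p with hE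
  have hroot (t : k) : E.eval t ≠ 0 := by
    intro h0
    have := (hf (t : OnePoint k)).1 (by
      intro v hv hP
      obtain ⟨c, hc⟩ := (Projectivization.mk_eq_mk_iff' k _ _ _ _).1 hP
      subst hc
      have h0' : sigmaForm p σ ((f.coord 0).eval t) ((f.coord 1).eval t) -
          (f.coord 2).eval t ^ p = 0 := by
        rw [← h0, hE]
        simp [sigmaForm, eval_finsetSum]
      rw [boundaryPoly, map_sub, eval_sigmaForm]
      simp only [MvPolynomial.eval_X, map_pow, valueAt_coe, Pi.smul_apply, smul_eq_mul,
        sigmaForm_mul_left, mul_pow]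
      rw [← mul_sub, h0', mul_zero])
    exact OnePoint.coe_ne_infty t this
  obtain ⟨κ', hκ'⟩ : ∃ κ', E = C κ' := by
    by_contra hne
    obtain ⟨t, ht⟩ := IsAlgClosed.exists_root E fun h => hne ⟨_, eq_C_of_degree_eq_zero h⟩
    exact hroot t ht
  have hκ'0 : κ' ≠ 0 := by
    rintro rfl
    exact hroot 0 (by rw [hκ']; simp)
  obtain ⟨κ, rfl⟩ : ∃ κ, κ' = κ ^ p := ⟨pthRoot p κ', (pthRoot_pow _).symm⟩
  have hκ : κ ≠ 0 := by rintro rfl; exact hκ'0 (zero_pow hp)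
  -- Otherwise `f₂` is constant as well, and since `d > 0` all three forms vanish at `∞`.
  have hne : f.coord 0 ≠ 0 ∨ f.coord 1 ≠ 0 := by
    by_contra! h
    have hs : sigmaForm p σ (0 : k[X]) 0 = 0 := by
      have := sigmaForm_mul_left (p := p) σ (0 : k[X]) 0 0
      simpa [hp] using this
    have h2 : f.coord 2 = C (-κ) := by
      rw [hE, h.1, h.2, hs, zero_sub] at hκ'
      apply pow_char_injective (p := p)
      have e : (-κ) ^ p = -κ ^ p := by
        have := sub_pow_char (0 : k) κ (p := p)
        simpa [hp] using this
      rw [← C_pow, e, C_neg, ← hκ', neg_neg]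
    apply f.valueAt_ne_zero OnePoint.infty
    rw [valueAt_infty]
    ext i
    fin_cases i
    · simp [h.1]
    · simp [h.2]
    · simp only [Fin.reduceFinMk, h2]
      rw [coeff_C, if_neg (by omega)]
      rfl
  obtain ⟨g, u, v, hg, huv, hu, hv⟩ : ∃ g u v : k[X], g ≠ 0 ∧ IsCoprime u v ∧
      f.coord 0 = g * u ∧ f.coord 1 = g * v := by
    classical
    have hg : EuclideanDomain.gcd (f.coord 0) (f.coord 1) ≠ 0 := by
      rw [Ne, EuclideanDomain.gcd_eq_zero_iff]
      tauto
    obtain ⟨u, hu⟩ := EuclideanDomain.gcd_dvd_left (f.coord 0) (f.coord 1)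
    obtain ⟨v, hv⟩ := EuclideanDomain.gcd_dvd_right (f.coord 0) (f.coord 1)
    refine ⟨_, u, v, hg, ?_, hu, hv⟩
    have hb := EuclideanDomain.gcd_eq_gcd_ab (f.coord 0) (f.coord 1)
    refine ⟨EuclideanDomain.gcdA (f.coord 0) (f.coord 1),
      EuclideanDomain.gcdB (f.coord 0) (f.coord 1), mul_left_cancel₀ hg ?_⟩
    conv_rhs => rw [mul_one, hb]
    linear_combination (-EuclideanDomain.gcdA (f.coord 0) (f.coord 1)) * hu
      - EuclideanDomain.gcdB (f.coord 0) (f.coord 1) * hv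
  have hder : derivative (sigmaForm p σ u v) = 0 := by
    have h1 : g ^ p * sigmaForm p σ u v = f.coord 2 ^ p + C (κ ^ p) := by
      rw [← sigmaForm_mul_left, ← hu, ← hv, ← hκ', hE]; ring
    have h2 := congrArg derivative h1
    rw [derivative_mul, derivative_add, derivative_pow, derivative_pow, derivative_C,
      CharP.cast_eq_zero k p] at h2
    simp only [map_zero, zero_mul, zero_add] at h2
    exact (mul_eq_zero.1 h2).resolve_left (pow_ne_zero _ hg)
  obtain ⟨hu', hv'⟩ := derivative_eq_zero_of_isCoprime hσ_one hσ_last huv hder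
  obtain ⟨V, rfl⟩ := exists_eq_pow_of_derivative_eq_zero (p := p) hu'
  obtain ⟨W, rfl⟩ := exists_eq_pow_of_derivative_eq_zero (p := p) hv'
  refine ⟨g, V, W, κ, hg, hκ, (IsCoprime.pow_iff (by omega) (by omega)).1 huv, hu, hv, ?_⟩
  apply pow_char_injective (p := p)
  rw [sub_pow_char, mul_pow, ← sigmaForm_pow, ← sigmaForm_mul_left, ← hu, ← hv, ← C_pow, ← hκ', hE]
  ring

end Structure

/-! ### Detecting a factor X^p - r by resultants -/

section Slice

/-- The polynomial `∑_{l ≤ n} x_{pl+j} X^l` cut out of `x` by the exponents congruent to `j`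
modulo `p`. -/
def slice {R : Type*} [Semiring R] (p n j : ℕ) (x : R[X]) : R[X] :=
  ∑ l ∈ Finset.range (n + 1), monomial l (x.coeff (p * l + j))

theorem map_slice {R S : Type*} [Semiring R] [Semiring S] (φ : R →+* S) (p n j : ℕ) (x : R[X]) :
    (slice p n j x).map φ = slice p n j (x.map φ) := by
  simp [slice, Polynomial.map_sum]

theorem natDegree_slice_le {R : Type*} [Semiring R] (p n j : ℕ) (x : R[X]) :
    (slice p n j x).natDegree ≤ n :=
  natDegree_sum_le_of_forall_le _ _ fun l hl =>
    (natDegree_monomial_le _).trans (by have := Finset.mem_range.1 hl; omega)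

theorem coeff_slice {R : Type*} [Semiring R] {p n : ℕ} (j : ℕ) {x : R[X]}
    (hx : x.natDegree < p * (n + 1)) (l : ℕ) : (slice p n j x).coeff l = x.coeff (p * l + j) := by
  simp only [slice, finsetSum_coeff, coeff_monomial, Finset.sum_ite_eq', Finset.mem_range]
  split_ifs with h
  · rfl
  · refine (coeff_eq_zero_of_natDegree_lt ?_).symm
    have : p * (n + 1) ≤ p * l := Nat.mul_le_mul_left _ (by omega)
    omega

variable {k : Type*} [Field k]

/-- Multiplication by `X^p` preserves exponents modulo `p`, so it acts on each slice as
multiplication by `X`. Thus a factor `X^p - r` of `x` is a common root `r` of all slices. -/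
theorem slice_mul_X_pow_sub_C {p n j : ℕ} (hj : j < p) {h : k[X]} {r : k}
    (hx : ((X ^ p - C r) * h).natDegree < p * (n + 1)) :
    slice p n j ((X ^ p - C r) * h) = (X - C r) * slice p n j h := by
  have hh : h.natDegree < p * (n + 1) := by
    by_cases h0 : h = 0
    · rw [h0, natDegree_zero]; exact Nat.mul_pos (by omega) n.succ_pos
    · rw [natDegree_mul (X_pow_sub_C_ne_zero (by omega) r) h0] at hx
      omega
  ext l
  rw [coeff_slice j hx, sub_mul, sub_mul, coeff_sub, coeff_sub, coeff_C_mul, coeff_C_mul,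
    coeff_slice j hh]
  congr 1
  rcases l with _ | l
  · rw [coeff_X_pow_mul', if_neg (by omega), mul_coeff_zero, coeff_X_zero, zero_mul]
  · rw [coeff_X_mul, coeff_slice j hh, show p * (l + 1) + j = p * l + j + p by ring,
      coeff_X_pow_mul]

theorem eq_sum_expand_slice {p n : ℕ} (hp : 0 < p) {x : k[X]} (hx : x.natDegree < p * (n + 1)) :
    x = ∑ j ∈ Finset.range p, X ^ j * expand k p (slice p n j x) := by
  ext m
  rw [finsetSum_coeff, Finset.sum_eq_single_of_mem (m % p) (Finset.mem_range.2 (Nat.mod_lt _ hp))]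
  · rw [coeff_X_pow_mul', if_pos (Nat.mod_le _ _), coeff_expand hp, if_pos (Nat.dvd_sub_mod m),
      coeff_slice _ hx]
    congr 1
    have h1 := Nat.div_add_mod m p
    rw [show m - m % p = p * (m / p) by omega, Nat.mul_div_cancel_left _ hp]
    exact h1.symm
  · intro j hj hjm
    rw [coeff_X_pow_mul']
    split_ifs with h
    · rw [coeff_expand hp, if_neg]
      rintro ⟨q, hq⟩
      apply hjm
      rw [show m = j + p * q by omega, Nat.add_mul_mod_self_left,
        Nat.mod_eq_of_lt (Finset.mem_range.1 hj)]
    · rfl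

theorem resultant_eq_zero_of_not_isCoprime {n : ℕ} {F G : k[X]} (hF : F.natDegree ≤ n)
    (hG : G.natDegree ≤ n) (hn : 0 < n) (h : ¬ IsCoprime F G) : resultant F G n n = 0 := by
  have key {F G : k[X]} (hF : F.natDegree = n) (hG : G.natDegree ≤ n) (h : ¬ IsCoprime F G) :
      resultant F G n n = 0 := by
    obtain ⟨m, hm⟩ := Nat.exists_eq_add_of_le hG
    conv_lhs => enter [4]; rw [hm]
    rw [resultant_add_right_deg _ _ _ _ _ le_rfl]
    have hF0 : F ≠ 0 := by rintro rfl; rw [natDegree_zero] at hF; omega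
    rw [← hF, resultant_eq_zero_iff.2 ⟨Or.inl hF0, h⟩, mul_zero]
  rcases hF.lt_or_eq with h1 | h1
  · rcases hG.lt_or_eq with h2 | h2
    · exact resultant_eq_zero_of_lt_lt _ _ _ _ h1 h2
    · rw [resultant_comm, key h2 hF fun h' => h h'.symm, mul_zero]
  · exact key h1 hG h

theorem not_isCoprime_of_resultant_eq_zero {n : ℕ} {F G : k[X]} (hF : F.natDegree = n)
    (hF0 : F ≠ 0) (hG : G.natDegree ≤ n) (h : resultant F G n n = 0) : ¬ IsCoprime F G := by
  obtain ⟨m, hm⟩ := Nat.exists_eq_add_of_le hG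
  have h2 : resultant F G n (G.natDegree + m) = 0 := by rw [← hm, h]
  rw [resultant_add_right_deg _ _ _ _ _ le_rfl] at h2
  subst hF
  have := (mul_eq_zero.1 h2).resolve_left
    (pow_ne_zero _ (leadingCoeff_ne_zero.2 hF0))
  exact (resultant_eq_zero_iff.1 this).2

/-- The resultants whose vanishing detects a factor `X^p - r`. -/
def sliceResultant {R : Type*} [CommRing R] (p d : ℕ) (y : Fin p → R) (x : R[X]) : R :=
  resultant (slice p (d / p) (d % p) x) (∑ j : Fin p, C (y j) * slice p (d / p) j x) (d / p) (d / p)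

theorem map_sliceResultant {R S : Type*} [CommRing R] [CommRing S] (φ : R →+* S) (p d : ℕ)
    (y : Fin p → R) (x : R[X]) :
    φ (sliceResultant p d y x) = sliceResultant p d (φ ∘ y) (x.map φ) := by
  have h : (∑ j : Fin p, C (y j) * slice p (d / p) j x).map φ =
      ∑ j : Fin p, C ((φ ∘ y) j) * slice p (d / p) j (x.map φ) := by
    simp [Polynomial.map_sum, map_slice]
  rw [sliceResultant, ← resultant_map_map, map_slice, h, sliceResultant]

theorem natDegree_sum_slice_le {R : Type*} [CommRing R] (p n : ℕ) (y : Fin p → R) (x : R[X]) :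
    (∑ j : Fin p, C (y j) * slice p n j x).natDegree ≤ n :=
  natDegree_sum_le_of_forall_le _ _ fun j _ =>
    (natDegree_C_mul_le _ _).trans (natDegree_slice_le p n j x)

/-- The resultant is taken in the formal degree `d / p`; a drop of the degree by `p` is a common
zero of the slices at infinity. -/
theorem sliceResultant_eq_zero_of_natDegree_le {p d : ℕ} (hp : 0 < p) (hd : p ≤ d) (y : Fin p → k)
    {x : k[X]} (hx : x.natDegree ≤ d - p) : sliceResultant p d y x = 0 := by
  have hn : 0 < d / p := Nat.div_pos hd hp
  have hdiv := Nat.div_add_mod d p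
  have hmod := Nat.mod_lt d hp
  obtain ⟨n, hn'⟩ : ∃ n, d / p = n + 1 := ⟨d / p - 1, by omega⟩
  have hx1 : x.natDegree < p * (n + 1) := by
    rw [hn'] at hdiv
    have : p * (n + 1) = p * n + p := by ring
    omega
  have hx2 : x.natDegree < p * (n + 1 + 1) := hx1.trans_le (Nat.mul_le_mul_left _ (by omega))
  have hs (j : ℕ) : (slice p (n + 1) j x).natDegree ≤ n := by
    rw [natDegree_le_iff_coeff_eq_zero]
    intro l hl
    rw [coeff_slice j hx2]
    apply coeff_eq_zero_of_natDegree_lt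
    have : p * (n + 1) ≤ p * l := Nat.mul_le_mul_left _ hl
    omega
  rw [sliceResultant, hn']
  refine resultant_eq_zero_of_lt_lt _ _ _ _ (Nat.lt_succ_of_le (hs _)) (Nat.lt_succ_of_le ?_)
  exact natDegree_sum_le_of_forall_le _ _ fun j _ => (natDegree_C_mul_le _ _).trans (hs j)

theorem sliceResultant_eq_zero_of_dvd {p d : ℕ} (hp : 0 < p) (hd : p ≤ d) (y : Fin p → k)
    {x : k[X]} (hx : x.natDegree ≤ d) {r : k} (h : X ^ p - C r ∣ x) :
    sliceResultant p d y x = 0 := by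
  have hn : 0 < d / p := Nat.div_pos hd hp
  have hdp : d < p * (d / p + 1) := Nat.lt_mul_div_succ d hp
  refine resultant_eq_zero_of_not_isCoprime (natDegree_slice_le _ _ _ _)
    (natDegree_sum_slice_le _ _ _ _) hn fun hc => ?_
  have hdvd {j : ℕ} (hj : j < p) : X - C r ∣ slice p (d / p) j x := by
    obtain ⟨h, rfl⟩ := h
    rw [slice_mul_X_pow_sub_C hj (hx.trans_lt hdp)]
    exact dvd_mul_right _ _
  exact not_isUnit_X_sub_C r (hc.isUnit_of_dvd' (hdvd (Nat.mod_lt _ hp))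
    (Finset.dvd_sum fun j _ => (hdvd j.2).mul_left _))

/-- The slice of index `d % p` has exact degree `d / p`, so each vanishing resultant gives an honest
common root with the combination `∑ y_j x_j`. As `y` varies, finitely many roots are available, and
a vector space over an infinite field is not a finite union of proper subspaces; hence one root is
common to all slices. -/
theorem exists_X_pow_sub_C_dvd [IsAlgClosed k] {p d : ℕ} (hp : 0 < p) {x : k[X]}
    (hx : x.natDegree = d) (hx0 : x ≠ 0) (h : ∀ y : Fin p → k, sliceResultant p d y x = 0) :
    ∃ r, X ^ p - C r ∣ x := by
  have hdp : x.natDegree < p * (d / p + 1) := hx ▸ Nat.lt_mul_div_succ d hp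
  classical
  set F := slice p (d / p) (d % p) x with hF
  have hlead : F.coeff (d / p) ≠ 0 := by
    rw [hF, coeff_slice _ hdp, Nat.div_add_mod, ← hx]
    exact leadingCoeff_ne_zero.2 hx0
  have hF0 : F ≠ 0 := by rintro h0; rw [h0] at hlead; simp at hlead
  have hFd : F.natDegree = d / p :=
    le_antisymm (natDegree_slice_le _ _ _ _) (le_natDegree_of_ne_zero hlead)
  let E (r : {r // r ∈ F.roots.toFinset}) : Subspace k (Fin p → k) :=
    LinearMap.ker (∑ j : Fin p, (slice p (d / p) j x).eval r.1 •
      (LinearMap.proj j : (Fin p → k) →ₗ[k] k))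
  have hE (r) (y : Fin p → k) :
      y ∈ E r ↔ ∑ j : Fin p, y j * (slice p (d / p) j x).eval r.1 = 0 := by
    simp [E, mul_comm]
  have hcover : ⋃ r, (E r : Set (Fin p → k)) = Set.univ := by
    refine Set.eq_univ_of_forall fun y => ?_
    have hc := not_isCoprime_of_resultant_eq_zero hFd hF0 (natDegree_sum_slice_le _ _ y _) (h y)
    rw [isCoprime_iff_aeval_ne_zero_of_isAlgClosed k k] at hc
    push Not at hc
    obtain ⟨r, hr1, hr2⟩ := hc
    rw [coe_aeval_eq_eval] at hr1 hr2
    refine Set.mem_iUnion.2 ⟨⟨r, by simpa [hF0] using hr1⟩, (hE _ y).2 ?_⟩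
    simpa [eval_finsetSum] using hr2
  obtain ⟨⟨r, hr⟩, htop⟩ := Subspace.exists_eq_top_of_iUnion_eq_univ hcover
  refine ⟨r, ?_⟩
  rw [eq_sum_expand_slice hp hdp]
  refine Finset.dvd_sum fun j hj => Dvd.dvd.mul_left ?_ _
  have hj' := Finset.mem_range.1 hj
  have : Pi.single (⟨j, hj'⟩ : Fin p) (1 : k) ∈ E ⟨r, hr⟩ := by rw [htop]; trivial
  rw [hE] at this
  simp only [Pi.single_apply, ite_mul, one_mul, zero_mul, Finset.sum_ite_eq', Finset.mem_univ,
    if_true] at this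
  obtain ⟨q, hq⟩ := dvd_iff_isRoot.2 this
  rw [hq, map_mul, map_sub, expand_X, expand_C]
  exact dvd_mul_right _ _

end Slice

/-! ### Linear relations and vanishing minors -/

section LinearRelation

variable {k : Type*} [Field k]

/-- The coefficients of degree `n` of `x`, `X^p x`, `y`, `X^p y`. -/
def relationRow {R : Type*} [CommRing R] (p : ℕ) (x y : R[X]) (n : ℕ) : Fin 4 → R :=
  ![x.coeff n, (X ^ p * x).coeff n, y.coeff n, (X ^ p * y).coeff n]

theorem map_relationRow {R S : Type*} [CommRing R] [CommRing S] (φ : R →+* S) (p : ℕ)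
    (x y : R[X]) (n : ℕ) (j : Fin 4) :
    φ (relationRow p x y n j) = relationRow p (x.map φ) (y.map φ) n j := by
  fin_cases j <;> simp [relationRow, coeff_X_pow_mul', apply_ite φ]

theorem relationRow_dotProduct (p : ℕ) (x y : k[X]) (z : Fin 4 → k) (n : ℕ) :
    relationRow p x y n ⬝ᵥ z =
      ((C (z 0) + C (z 1) * X ^ p) * x + (C (z 2) + C (z 3) * X ^ p) * y).coeff n := by
  simp [relationRow, dotProduct, Fin.sum_univ_four, add_mul, mul_assoc, coeff_add, coeff_C_mul]
  ring

theorem exists_forall_dotProduct_eq_zero {m : ℕ} (w : ℕ → Fin m → k)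
    (h : ∀ e : Fin m → ℕ, Matrix.det (Matrix.of fun i j => w (e i) j) = 0) :
    ∃ z : Fin m → k, z ≠ 0 ∧ ∀ n, w n ⬝ᵥ z = 0 := by
  by_cases htop : Submodule.span k (Set.range w) = ⊤
  · exfalso
    obtain ⟨v, hv1, -, hv3⟩ := Submodule.exists_fun_fin_finrank_span_eq k (Set.range w)
    have hr : Module.finrank k (Submodule.span k (Set.range w)) = m := by
      rw [htop, finrank_top, Module.finrank_fin_fun]
    generalize Module.finrank k (Submodule.span k (Set.range w)) = m' at v hv1 hv3 hr
    subst hr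
    choose e he using hv1
    have := Matrix.linearIndependent_rows_iff_isUnit (A := Matrix.of v) |>.1 hv3
    rw [Matrix.isUnit_iff_isUnit_det] at this
    apply this.ne_zero
    rw [← h e]
    congr 1
    ext i j
    simp [he]
  · obtain ⟨φ, hφ, hle⟩ := Submodule.exists_le_ker_of_lt_top _ (lt_top_iff_ne_top.2 htop)
    have hz (u : Fin m → k) : φ u = u ⬝ᵥ fun j => φ (Pi.single j 1) := by
      rw [LinearMap.pi_apply_eq_sum_univ φ u]
      simp only [dotProduct, smul_eq_mul]
      refine Finset.sum_congr rfl fun j _ => ?_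
      congr 2
      ext i
      simp [Pi.single_apply, eq_comm]
    refine ⟨fun j => φ (Pi.single j 1), ?_, fun n => ?_⟩
    · intro h0
      apply hφ
      refine LinearMap.ext fun u => ?_
      rw [hz, h0, dotProduct_zero, LinearMap.zero_apply]
    · rw [← hz]
      exact hle (Submodule.subset_span ⟨n, rfl⟩)

end LinearRelation

/-! ### Closed conditions and the normal form on the closure -/

section Component

variable {k : Type*} [Field k]

/-- The `i`-th coordinate of the universal triple of forms of degree `d`. -/
def universalCoord (k : Type*) [Field k] (d : ℕ) (i : Fin 3) :
    (MvPolynomial (Fin 3 × Fin (d + 1)) k)[X] :=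
  ∑ n : Fin (d + 1), monomial (n : ℕ) (MvPolynomial.X (i, n))

theorem map_universalCoord {d : ℕ} (f : PlaneMap k d) (i : Fin 3) :
    (universalCoord k d i).map (MvPolynomial.eval f.coeffs) = f.coord i := by
  rw [universalCoord, Polynomial.map_sum]
  simp only [map_monomial, MvPolynomial.eval_X, PlaneMap.coeffs]
  rw [Fin.sum_univ_eq_sum_range (fun n => monomial n ((f.coord i).coeff n)),
    ← as_sum_range' _ _ (Nat.lt_succ_of_le (f.natDegree_le i))]

variable {p : ℕ} {σ : ℕ → k} {d m : ℕ}

theorem eval_coeffs_eq_zero_of_mem_component {f : PlaneMap k d} (hf : f ∈ component p σ d m)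
    (F : MvPolynomial (Fin 3 × Fin (d + 1)) k)
    (hF : ∀ g ∈ stratum p σ d m, MvPolynomial.eval g.coeffs F = 0) :
    MvPolynomial.eval f.coeffs F = 0 := by
  have h := MvPolynomial.mem_zeroLocus_iff.1 hf.2 F (by
    rw [MvPolynomial.mem_vanishingIdeal_iff]
    rintro _ ⟨g, hg, rfl⟩
    exact hF g hg)
  exact h

theorem eq_zero_of_pow_char_eq {V : k[X]} (hV : V.natDegree ≤ 1)
    (h0 : V.coeff 0 ^ p = 0) (h1 : V.coeff 1 ^ p = 0) : V = 0 := by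
  rw [eq_X_add_C_of_natDegree_le_one hV, eq_zero_of_pow_eq_zero h0, eq_zero_of_pow_eq_zero h1]
  simp

variable [Fact p.Prime]

theorem natDegree_le_one_of_mul_pow {g V : k[X]} {d : ℕ} (hg : g ≠ 0) (hgd : d - p ≤ g.natDegree)
    (hd : p ≤ d) (h : (g * V ^ p).natDegree ≤ d) : V.natDegree ≤ 1 := by
  have hp : 0 < p := (Fact.out : p.Prime).pos
  by_cases hV : V = 0
  · simp [hV]
  · rw [natDegree_mul hg (pow_ne_zero _ hV), natDegree_pow] at h
    by_contra! h2
    have : p * 2 ≤ p * V.natDegree := Nat.mul_le_mul_left _ h2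
    omega

theorem natDegree_le_one_of_dvd {W : k[X]} {z₀ z₁ : k}
    (hz : (C z₀ + C z₁ * X ^ p : k[X]) ≠ 0) (h : W ^ p ∣ C z₀ + C z₁ * X ^ p) :
    W.natDegree ≤ 1 := by
  have hp : 0 < p := (Fact.out : p.Prime).pos
  have h1 := natDegree_le_of_dvd h hz
  have h2 : (C z₀ + C z₁ * X ^ p : k[X]).natDegree ≤ p := by compute_degree!
  rw [natDegree_pow] at h1
  by_contra! h3
  have : p * 2 ≤ p * W.natDegree := Nat.mul_le_mul_left _ h3
  omega

theorem C_add_C_mul_X_pow_eq_zero_iff {z₀ z₁ : k} :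
    (C z₀ + C z₁ * X ^ p : k[X]) = 0 ↔ z₀ = 0 ∧ z₁ = 0 := by
  have hp : p ≠ 0 := (Fact.out : p.Prime).ne_zero
  refine ⟨fun h => ?_, ?_⟩
  · have h0 := congrArg (fun q => coeff q 0) h
    have h1 := congrArg (fun q => coeff q p) h
    simp [hp, coeff_C, coeff_X_pow, hp.symm] at h0 h1
    exact ⟨h0, h1⟩
  · rintro ⟨rfl, rfl⟩
    simp

variable [CharP k p]

theorem pow_char_of_natDegree_le_one {V : k[X]} (hV : V.natDegree ≤ 1) :
    V ^ p = C (V.coeff 0 ^ p) + C (V.coeff 1 ^ p) * X ^ p := by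
  conv_lhs => rw [eq_X_add_C_of_natDegree_le_one hV]
  rw [add_pow_char, mul_pow, ← C_pow, ← C_pow, add_comm]

variable [IsAlgClosed k]

theorem exists_eq_of_mem_stratum (hσ_one : σ 1 = 1) (hσ_last : σ (p - 1) = 1) (hd : p ≤ d)
    {f : PlaneMap k d} (hf : f ∈ stratum p σ d (d - p)) :
    ∃ g V W : k[X], g.natDegree = d - p ∧ V.natDegree ≤ 1 ∧ W.natDegree ≤ 1 ∧ IsCoprime V W ∧
      f.coord 0 = g * V ^ p ∧ f.coord 1 = g * W ^ p := by
  obtain ⟨g, V, W, κ, hg, -, hc, h0, h1, -⟩ := hf.1.exists_eq hσ_one hσ_last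
  have hdeg : g.natDegree = d - p := by
    rw [← hf.2, PlaneMap.multStr, h0, h1]
    -- `V^p` and `W^p` generate the unit ideal, so the multiplicity at `str` is the degree of `g`.
    have hspan : Ideal.span {g * V ^ p, g * W ^ p} = Ideal.span {g} := by
      apply le_antisymm
      · rw [Ideal.span_le]
        rintro x (rfl | rfl)
        · exact Ideal.mem_span_singleton.2 (dvd_mul_right _ _)
        · exact Ideal.mem_span_singleton.2 (dvd_mul_right _ _)
      · rw [Ideal.span_singleton_le_iff_mem, Ideal.mem_span_pair]
        obtain ⟨a, b, hab⟩ : IsCoprime (V ^ p) (W ^ p) := hc.pow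
        exact ⟨a, b, by linear_combination g * hab⟩
    rw [hspan, finrank_quotient_span_eq_natDegree]
  exact ⟨g, V, W, hdeg, natDegree_le_one_of_mul_pow hg hdeg.ge hd (h0 ▸ f.natDegree_le 0),
    natDegree_le_one_of_mul_pow hg hdeg.ge hd (h1 ▸ f.natDegree_le 1), hc, h0, h1⟩

/-- On a curve in the closure of the stratum the first two coordinates satisfy a linear relation
with coefficients in `⟨1, X^p⟩`. -/
theorem exists_linear_relation (hσ_one : σ 1 = 1) (hσ_last : σ (p - 1) = 1) (hd : p ≤ d)
    {f : PlaneMap k d} (hf : f ∈ component p σ d (d - p)) :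
    ∃ z : Fin 4 → k, z ≠ 0 ∧
      (C (z 0) + C (z 1) * X ^ p) * f.coord 0 + (C (z 2) + C (z 3) * X ^ p) * f.coord 1 = 0 := by
  have hp : p ≠ 0 := (Fact.out : p.Prime).ne_zero
  have heval (g : PlaneMap k d) (e : Fin 4 → ℕ) :
      MvPolynomial.eval g.coeffs (Matrix.det (Matrix.of fun i j =>
        relationRow p (universalCoord k d 0) (universalCoord k d 1) (e i) j)) =
      Matrix.det (Matrix.of fun i j => relationRow p (g.coord 0) (g.coord 1) (e i) j) := by
    rw [RingHom.map_det]
    congr 1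
    ext i j
    simp only [RingHom.mapMatrix_apply, Matrix.map_apply, Matrix.of_apply]
    rw [map_relationRow, map_universalCoord, map_universalCoord]
  obtain ⟨z, hz, hrel⟩ := exists_forall_dotProduct_eq_zero
    (fun n => relationRow p (f.coord 0) (f.coord 1) n) fun e => by
      rw [← heval]
      refine eval_coeffs_eq_zero_of_mem_component hf _ fun g hg => ?_
      rw [heval]
      obtain ⟨G, V, W, -, hV, hW, hc, h0, h1⟩ := exists_eq_of_mem_stratum hσ_one hσ_last hd hg
      -- The relation is `W^p f₀ - V^p f₁ = 0`; since `V`, `W` have degree at most 1, their p-th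
      -- powers lie in `⟨1, X^p⟩`.
      refine Matrix.exists_mulVec_eq_zero_iff.1
        ⟨![W.coeff 0 ^ p, W.coeff 1 ^ p, -V.coeff 0 ^ p, -V.coeff 1 ^ p], fun hz => ?_, ?_⟩
      · have e0 := congrFun hz 0
        have e1 := congrFun hz 1
        have e2 := congrFun hz 2
        have e3 := congrFun hz 3
        simp only [Matrix.cons_val, Pi.zero_apply, neg_eq_zero] at e0 e1 e2 e3
        rw [eq_zero_of_pow_char_eq hV e2 e3, eq_zero_of_pow_char_eq hW e0 e1] at hc
        exact not_isCoprime_zero_zero hc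
      · ext i
        simp only [Matrix.mulVec]
        change relationRow p _ _ _ ⬝ᵥ _ = 0
        rw [relationRow_dotProduct]
        simp only [Matrix.cons_val, C_neg, neg_mul, ← sub_eq_add_neg]
        rw [← pow_char_of_natDegree_le_one hW]
        rw [show -C (V.coeff 0 ^ p) - C (V.coeff 1 ^ p) * X ^ p = - V ^ p by
          rw [pow_char_of_natDegree_le_one hV]; ring, h0, h1,
          show W ^ p * (G * V ^ p) + -V ^ p * (G * W ^ p) = 0 by ring, coeff_zero]
  refine ⟨z, hz, ?_⟩
  ext n
  rw [← relationRow_dotProduct, hrel, coeff_zero]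

theorem sliceResultant_coord_eq_zero (hσ_one : σ 1 = 1) (hσ_last : σ (p - 1) = 1) (hd : p ≤ d)
    {f : PlaneMap k d} (hf : f ∈ component p σ d (d - p)) (y : Fin p → k) {i : Fin 3}
    (hi : i = 0 ∨ i = 1) : sliceResultant p d y (f.coord i) = 0 := by
  have hp : 0 < p := (Fact.out : p.Prime).pos
  have heval (g : PlaneMap k d) :
      MvPolynomial.eval g.coeffs
        (sliceResultant p d (MvPolynomial.C ∘ y) (universalCoord k d i)) =
      sliceResultant p d y (g.coord i) := by
    rw [map_sliceResultant, map_universalCoord]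
    congr 1
    ext j
    simp
  rw [← heval]
  refine eval_coeffs_eq_zero_of_mem_component hf _ fun g hg => ?_
  rw [heval]
  obtain ⟨G, V, W, hG, hV, hW, -, h0, h1⟩ := exists_eq_of_mem_stratum hσ_one hσ_last hd hg
  obtain ⟨U, hU, hx⟩ : ∃ U : k[X], U.natDegree ≤ 1 ∧ g.coord i = G * U ^ p := by
    rcases hi with rfl | rfl
    · exact ⟨V, hV, h0⟩
    · exact ⟨W, hW, h1⟩
  -- Either `U` is constant and the coordinate has degree at most `d - p`, or `U^p` is a multiple of
  -- some `X^p - r`.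
  by_cases hU1 : U.coeff 1 = 0
  · refine sliceResultant_eq_zero_of_natDegree_le hp hd y ?_
    rw [hx, pow_char_of_natDegree_le_one hU, hU1, zero_pow hp.ne', C_0, zero_mul, add_zero]
    exact (natDegree_mul_C_le _ _).trans hG.le
  · refine sliceResultant_eq_zero_of_dvd hp hd y (g.natDegree_le i)
      (r := -(U.coeff 0 / U.coeff 1) ^ p) ?_
    rw [hx, pow_char_of_natDegree_le_one hU]
    refine Dvd.dvd.mul_left ⟨C (U.coeff 1 ^ p), ?_⟩ _
    rw [sub_mul, ← C_mul, neg_mul, ← mul_pow, div_mul_cancel₀ _ hU1, C_neg]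
    ring

/-- Normal form of the curves in the closure of the stratum. -/
theorem exists_eq_of_mem_component (hσ_one : σ 1 = 1) (hσ_last : σ (p - 1) = 1) (hd : p ≤ d)
    {f : PlaneMap k d} (hf : f ∈ component p σ d (d - p)) :
    ∃ (g V W : k[X]) (κ : k), g.natDegree = d - p ∧ g ≠ 0 ∧ κ ≠ 0 ∧
      V.natDegree ≤ 1 ∧ W.natDegree ≤ 1 ∧
      f.coord 0 = g * V ^ p ∧ f.coord 1 = g * W ^ p ∧
      f.coord 2 = g * sigmaForm p (fun i => pthRoot p (σ i)) V W - C κ := by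
  have hp : 0 < p := (Fact.out : p.Prime).pos
  obtain ⟨g, V, W, κ, hg, hκ, hc, h0, h1, h2⟩ := hf.1.exists_eq hσ_one hσ_last
  obtain ⟨z, hz, hrel⟩ := exists_linear_relation hσ_one hσ_last hd hf
  set A : k[X] := C (z 0) + C (z 1) * X ^ p with hA
  set B : k[X] := C (z 2) + C (z 3) * X ^ p with hB
  have hrel' : A * V ^ p + B * W ^ p = 0 := by
    apply mul_left_cancel₀ hg
    rw [h0, h1] at hrel
    linear_combination hrel
  have hAB : A ≠ 0 ∨ B ≠ 0 := by
    by_contra! h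
    obtain ⟨e0, e1⟩ := C_add_C_mul_X_pow_eq_zero_iff.1 h.1
    obtain ⟨e2, e3⟩ := C_add_C_mul_X_pow_eq_zero_iff.1 h.2
    apply hz
    ext i
    fin_cases i <;> assumption
  -- From `A V^p = -B W^p` and coprimality, `W^p` divides `A`, whose degree is at most `p`. If `A =
  -- 0` then `W = 0`.
  have hW : W.natDegree ≤ 1 := by
    by_cases hA0 : A = 0
    · have : W = 0 := by
        rw [hA0, zero_mul, zero_add] at hrel'
        exact eq_zero_of_pow_eq_zero
          ((mul_eq_zero.1 hrel').resolve_left (hAB.resolve_left (not_not.2 hA0)))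
      simp [this]
    · refine natDegree_le_one_of_dvd hA0 ?_
      exact (hc.symm.pow : IsCoprime (W ^ p) (V ^ p)).dvd_of_dvd_mul_right
        ⟨-B, by linear_combination hrel'⟩
  have hV : V.natDegree ≤ 1 := by
    by_cases hB0 : B = 0
    · have : V = 0 := by
        rw [hB0, zero_mul, add_zero] at hrel'
        exact eq_zero_of_pow_eq_zero
          ((mul_eq_zero.1 hrel').resolve_left (hAB.resolve_right (not_not.2 hB0)))
      simp [this]
    · refine natDegree_le_one_of_dvd hB0 ?_
      exact (hc.pow : IsCoprime (V ^ p) (W ^ p)).dvd_of_dvd_mul_right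
        ⟨-A, by linear_combination hrel'⟩
  have hsig := natDegree_sigmaForm_le (p := p) (fun i => pthRoot p (σ i)) hV hW
  have hV0 := f.natDegree_le 0
  have hW0 := f.natDegree_le 1
  -- For constant `V`, `W` the linear relation says nothing about `g`, which has degree `d`; the
  -- resultants then provide its factor `X^p - r`.
  by_cases hcst : V.natDegree = 0 ∧ W.natDegree = 0
  · obtain ⟨α, rfl⟩ : ∃ α, V = C α := ⟨_, eq_C_of_natDegree_eq_zero hcst.1⟩
    obtain ⟨β, rfl⟩ : ∃ β, W = C β := ⟨_, eq_C_of_natDegree_eq_zero hcst.2⟩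
    obtain ⟨τ, hτ⟩ : ∃ τ : k, sigmaForm p (fun i => pthRoot p (σ i)) (C α) (C β) = C τ :=
      ⟨_, (map_sigmaForm CAlgHom (fun i => pthRoot p (σ i)) α β).symm⟩
    have hαβ : α ≠ 0 ∨ β ≠ 0 := by
      by_contra! h
      rw [h.1, h.2, C_0] at hc
      exact not_isCoprime_zero_zero hc
    have hgd : g.natDegree = d := by
      have hgle : g.natDegree ≤ d := by
        rcases hαβ with h | h
        · rwa [h0, ← C_pow, natDegree_mul_C (pow_ne_zero _ h)] at hV0
        · rwa [h1, ← C_pow, natDegree_mul_C (pow_ne_zero _ h)] at hW0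
      refine le_antisymm hgle (not_lt.1 fun hlt => ?_)
      have hgc : g.coeff d = 0 := coeff_eq_zero_of_natDegree_lt hlt
      apply f.valueAt_ne_zero OnePoint.infty
      rw [valueAt_infty]
      ext i
      fin_cases i
      · simp only [Fin.zero_eta, h0, ← C_pow, coeff_mul_C, hgc, zero_mul, Pi.zero_apply]
      · simp only [Fin.mk_one, h1, ← C_pow, coeff_mul_C, hgc, zero_mul, Pi.zero_apply]
      · simp only [Fin.reduceFinMk, h2, hτ, coeff_sub, coeff_mul_C, hgc, zero_mul, Pi.zero_apply]
        rw [coeff_C, if_neg (by omega), sub_zero]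
    obtain ⟨r, hr⟩ : ∃ r, X ^ p - C r ∣ g := by
      obtain ⟨i, hi, γ, hγ, hx⟩ : ∃ i : Fin 3, (i = 0 ∨ i = 1) ∧ ∃ γ : k, γ ≠ 0 ∧
          f.coord i = g * C γ := by
        rcases hαβ with h | h
        · exact ⟨0, Or.inl rfl, α ^ p, pow_ne_zero _ h, by rw [h0, C_pow]⟩
        · exact ⟨1, Or.inr rfl, β ^ p, pow_ne_zero _ h, by rw [h1, C_pow]⟩
      obtain ⟨r, hr⟩ := exists_X_pow_sub_C_dvd (d := d) hp (x := f.coord i)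
        (by rw [hx, natDegree_mul_C hγ, hgd]) (by rw [hx]; exact mul_ne_zero hg (C_ne_zero.2 hγ))
        (fun y => sliceResultant_coord_eq_zero hσ_one hσ_last hd hf y hi)
      rw [hx] at hr
      exact ⟨r, (IsUnit.dvd_mul_right (isUnit_C.2 hγ.isUnit)).1 hr⟩
    obtain ⟨G, rfl⟩ := hr
    obtain ⟨ρ, rfl⟩ : ∃ ρ, r = ρ ^ p := ⟨pthRoot p r, (pthRoot_pow _).symm⟩
    have hT : (X ^ p - C (ρ ^ p) : k[X]) = (X - C ρ) ^ p := by rw [sub_pow_char, C_pow]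
    have hG0 : G ≠ 0 := right_ne_zero_of_mul hg
    -- The factor `X^p - r = (X - ρ)^p` moves into `V^p` and `W^p`, at the price of their
    -- coprimality.
    refine ⟨G, (X - C ρ) * C α, (X - C ρ) * C β, κ, ?_, hG0, hκ, ?_, ?_, ?_, ?_, ?_⟩
    · rw [natDegree_mul (left_ne_zero_of_mul hg) hG0, natDegree_X_pow_sub_C] at hgd
      omega
    · exact (natDegree_mul_C_le _ _).trans (natDegree_X_sub_C_le _)
    · exact (natDegree_mul_C_le _ _).trans (natDegree_X_sub_C_le _)
    · rw [h0, hT, mul_pow]; ring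
    · rw [h1, hT, mul_pow]; ring
    · rw [h2, hT, sigmaForm_mul_left]; ring
  · have hone : V.natDegree = 1 ∨ W.natDegree = 1 := by omega
    refine ⟨g, V, W, κ, ?_, hg, hκ, hV, hW, h0, h1, h2⟩
    have hgle : g.natDegree + p ≤ d := by
      rcases hone with h | h
      · rwa [h0, natDegree_mul hg (pow_ne_zero _ (by rintro rfl; simp at h)), natDegree_pow, h,
          mul_one] at hV0
      · rwa [h1, natDegree_mul hg (pow_ne_zero _ (by rintro rfl; simp at h)), natDegree_pow, h,
          mul_one] at hW0
    -- If `deg g < d - p`, all three coefficients of `t^d` vanish and the map is undefined at `∞`.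
    refine le_antisymm (by omega) (not_lt.1 fun hlt => ?_)
    have hpow {U : k[X]} (hU : U.natDegree ≤ 1) : (U ^ p).natDegree ≤ p := by
      simpa using natDegree_pow_le_of_le p hU
    have hsmall {U : k[X]} (hU : U.natDegree ≤ p) : (g * U).coeff d = 0 :=
      coeff_eq_zero_of_natDegree_lt (natDegree_mul_le.trans_lt (by omega))
    apply f.valueAt_ne_zero OnePoint.infty
    rw [valueAt_infty]
    ext i
    fin_cases i
    · simp only [Fin.zero_eta, h0, hsmall (hpow hV), Pi.zero_apply]
    · simp only [Fin.mk_one, h1, hsmall (hpow hW), Pi.zero_apply]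
    · simp only [Fin.reduceFinMk, h2, coeff_sub, hsmall hsig, Pi.zero_apply]
      rw [coeff_C, if_neg (by omega), sub_zero]

end Component

/-! ### Normalizing the coefficients of the parameterization -/

section Existence

variable {k : Type*} [Field k] {p : ℕ} [Fact p.Prime] [CharP k p] [IsAlgClosed k]
  {σ : ℕ → k} {d : ℕ}

theorem exists_eq_paramM {g : k[X]} (hg : g.Monic) : ∃ a : ℕ → k, g = paramM g.natDegree a := by
  induction hn : g.natDegree generalizing g with
  | zero => exact ⟨0, by rw [hg.natDegree_eq_zero.1 hn]; simp [paramM]⟩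
  | succ n ih =>
    obtain ⟨t, ht⟩ := IsAlgClosed.exists_root g fun h => by
      have := natDegree_eq_zero_iff_degree_le_zero.2 h.le
      omega
    obtain ⟨h, rfl⟩ := dvd_iff_isRoot.2 ht
    have hh : h.Monic := (monic_X_sub_C t).of_mul_monic_left hg
    rw [(monic_X_sub_C t).natDegree_mul hh, natDegree_X_sub_C] at hn
    obtain ⟨a, ha⟩ := ih hh (by omega)
    refine ⟨Function.update a (n + 1) (-t), ?_⟩
    rw [paramM, Finset.prod_Icc_succ_top (by omega), ← Finset.prod_congr rfl
      (g := fun j => X + C (Function.update a (n + 1) (-t) j))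
      (f := fun j => X + C (a j))]
    · rw [← paramM, ← ha, Function.update_self, C_neg, mul_comm, sub_eq_add_neg]
    · intro j hj
      rw [Function.update_of_ne]
      have := Finset.mem_Icc.1 hj
      omega

theorem exists_eq_paramM_of_coeff_zero {g : k[X]} (hg : g.Monic)
    (h0 : g.natDegree ≠ 0 → g.coeff 0 = 0) :
    ∃ a : ℕ → k, g = paramM g.natDegree a ∧ (g.natDegree ≠ 0 → a g.natDegree = 0) := by
  by_cases hn : g.natDegree = 0
  · obtain ⟨a, ha⟩ := exists_eq_paramM hg
    exact ⟨a, ha, fun h => absurd hn h⟩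
  · obtain ⟨h, rfl⟩ := X_dvd_iff.2 (h0 hn)
    have hh : h.Monic := monic_X.of_mul_monic_left hg
    obtain ⟨a, ha⟩ := exists_eq_paramM hh
    rw [monic_X.natDegree_mul hh, natDegree_X, add_comm]
    refine ⟨Function.update a (h.natDegree + 1) 0, ?_, fun _ => Function.update_self ..⟩
    rw [paramM, Finset.prod_Icc_succ_top (by omega), ← Finset.prod_congr rfl
      (g := fun j => X + C (Function.update a (h.natDegree + 1) 0 j))
      (f := fun j => X + C (a j))]
    · rw [← paramM, ← ha, Function.update_self, C_0, mul_comm, add_zero]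
    · intro j hj
      rw [Function.update_of_ne]
      have := Finset.mem_Icc.1 hj
      omega

theorem exists_hasParameterization (hσ_one : σ 1 = 1) (hσ_last : σ (p - 1) = 1) (hd : p ≤ d)
    {f : PlaneMap k d} (hf : f ∈ component p σ d (d - p)) :
    ∃ (a : ℕ → k) (b c : Fin 2 → k), HasParameterization p σ (d - p) f a b c ∧
      (d - p ≠ 0 → a (d - p) = 0) := by
  obtain ⟨g, V, W, κ, hgd, hg, hκ, hV, hW, h0, h1, h2⟩ :=
    exists_eq_of_mem_component hσ_one hσ_last hd hf
  obtain ⟨s, hs⟩ : ∃ s, g.natDegree ≠ 0 → g.eval s = 0 := by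
    by_cases hn : g.natDegree = 0
    · exact ⟨0, fun h => absurd hn h⟩
    · obtain ⟨s, hs⟩ := IsAlgClosed.exists_root g fun h =>
        hn (natDegree_eq_zero_iff_degree_le_zero.2 h.le)
      exact ⟨s, fun _ => hs⟩
  have hlc : g.leadingCoeff ≠ 0 := leadingCoeff_ne_zero.2 hg
  -- Dividing by `κ` turns the constant into 1 and making `g` monic leaves the factor `μ`, whose
  -- p-th root is absorbed into `V` and `W`. The shift by `s` puts a root of `g` at 0.
  set μ := g.leadingCoeff / κ with hμ
  have hμ0 : μ ≠ 0 := div_ne_zero hlc hκ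
  set M := C g.leadingCoeff⁻¹ * g.comp (X + C s) with hM
  have hMmonic : M.Monic := by
    rw [Monic, hM, leadingCoeff_mul, leadingCoeff_C, leadingCoeff_comp (by simp)]
    simp [hlc]
  have hMdeg : M.natDegree = d - p := by
    rw [hM, natDegree_C_mul (inv_ne_zero hlc), natDegree_comp, natDegree_X_add_C, mul_one, hgd]
  obtain ⟨a, ha, ha0⟩ := exists_eq_paramM_of_coeff_zero hMmonic (by
    intro h
    rw [hMdeg, ← hgd] at h
    rw [hM, coeff_C_mul, coeff_zero_eq_eval_zero, eval_comp]
    simp [hs h])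
  rw [hMdeg] at ha ha0
  set ν := pthRoot p μ with hν
  have hνp : ν ^ p = μ := pthRoot_pow μ
  have hlin {U : k[X]} (hU : U.natDegree ≤ 1) :
      ∃ b : Fin 2 → k, paramV p b = C ν * U.comp (X + C s) := by
    set U' := C ν * U.comp (X + C s) with hU'
    have hdeg : U'.natDegree ≤ 1 := by
      refine (natDegree_C_mul_le _ _).trans ?_
      rwa [natDegree_comp, natDegree_X_add_C, mul_one]
    refine ⟨![U'.coeff 0 ^ p, U'.coeff 1 ^ p], ?_⟩
    rw [paramV]
    simp only [Matrix.cons_val, pthRoot_pow_self]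
    conv_rhs => rw [eq_X_add_C_of_natDegree_le_one hdeg]
    ring
  obtain ⟨b, hb⟩ := hlin hV
  obtain ⟨c, hc⟩ := hlin hW
  refine ⟨a, b, c, ⟨1, s, κ, one_ne_zero, hκ, ?_⟩, ha0⟩
  have hcoef : C κ * (C g.leadingCoeff⁻¹ * C ν ^ p) = 1 := by
    rw [← C_pow, hνp, hμ, ← C_mul, ← C_mul, ← C_1]
    congr 1
    field_simp
  have hcomp (U : k[X]) : (g * U ^ p).comp (X + C s) =
      C κ * (paramM (d - p) a * (C ν * U.comp (X + C s)) ^ p) := by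
    rw [← ha, hM, mul_comp, pow_comp, mul_pow]
    linear_combination (-(g.comp (X + C s) * U.comp (X + C s) ^ p)) * hcoef
  intro i
  rw [C_1, one_mul]
  fin_cases i
  · simp only [Fin.zero_eta, paramTriple, Matrix.cons_val, h0, hb]
    exact hcomp V
  · simp only [Fin.mk_one, paramTriple, Matrix.cons_val, h1, hc]
    exact hcomp W
  · simp only [Fin.reduceFinMk, paramTriple, Matrix.cons_val, h2, hb, hc]
    have hsig : (sigmaForm p (fun i => pthRoot p (σ i)) V W).comp (X + C s) =
        sigmaForm p (fun i => pthRoot p (σ i)) (V.comp (X + C s)) (W.comp (X + C s)) := by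
      have := map_sigmaForm (p := p) (aeval (X + C s) : k[X] →ₐ[k] k[X])
        (fun i => pthRoot p (σ i)) V W
      simpa only [← comp_eq_aeval] using this
    rw [sigmaForm_mul_left, ← ha, hM, sub_comp, mul_comp, C_comp, hsig]
    linear_combination (-(g.comp (X + C s) * sigmaForm p (fun i => pthRoot p (σ i))
      (V.comp (X + C s)) (W.comp (X + C s)))) * hcoef

end Existence

/-! ### Squarefreeness of the equation -/

section Squarefree

variable {k : Type*} [Field k]

/-- The derivation with `x₀ ↦ b₁`, `x₁ ↦ c₁`, `x₂ ↦ 0`. -/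
def lineDerivation (b c : Fin 2 → k) :
    Derivation k (MvPolynomial (Fin 3) k) (MvPolynomial (Fin 3) k) :=
  MvPolynomial.mkDerivation k ![MvPolynomial.C (b 1), MvPolynomial.C (c 1), 0]

/-- Restriction to the line `L₁ = π`, `x₂ = 0`, with coordinate `L₀ / π`. -/
def lineRestriction (b c : Fin 2 → k) : MvPolynomial (Fin 3) k →ₐ[k] k[X] :=
  MvPolynomial.aeval ![C (b 1) * X - C (b 0), C (c 1) * X - C (c 0), 0]

theorem lineRestriction_lineDerivation (b c : Fin 2 → k) (F : MvPolynomial (Fin 3) k) :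
    lineRestriction b c (lineDerivation b c F) = derivative (lineRestriction b c F) := by
  induction F using MvPolynomial.induction_on with
  | C a =>
    rw [← MvPolynomial.algebraMap_eq, Derivation.map_algebraMap, map_zero, AlgHom.commutes,
      Polynomial.algebraMap_eq, derivative_C]
  | add F G hF hG => rw [map_add, map_add, hF, hG, map_add, map_add]
  | mul_X F i hF =>
    have hi : lineRestriction b c (lineDerivation b c (MvPolynomial.X i)) =
        derivative (lineRestriction b c (MvPolynomial.X i)) := by
      fin_cases i <;> simp [lineRestriction, lineDerivation, MvPolynomial.mkDerivation_X]
    rw [Derivation.leibniz, map_add, smul_eq_mul, smul_eq_mul, map_mul, map_mul, map_mul, hF, hi,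
      derivative_mul]
    ring

theorem lineDerivation_mem_supported (b c : Fin 2 → k) {F : MvPolynomial (Fin 3) k}
    (hF : F ∈ MvPolynomial.supported k ({0, 1} : Set (Fin 3))) :
    lineDerivation b c F ∈ MvPolynomial.supported k ({0, 1} : Set (Fin 3)) := by
  induction hF using Algebra.adjoin_induction with
  | mem x hx =>
    obtain ⟨i, hi, rfl⟩ := hx
    rcases hi with rfl | rfl
    · simpa [lineDerivation, MvPolynomial.mkDerivation_X] using
        (MvPolynomial.supported k ({0, 1} : Set (Fin 3))).algebraMap_mem (b 1)
    · simpa [lineDerivation, MvPolynomial.mkDerivation_X] using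
        (MvPolynomial.supported k ({0, 1} : Set (Fin 3))).algebraMap_mem (c 1)
  | algebraMap r => rw [Derivation.map_algebraMap]; exact zero_mem _
  | add x y hx hy ihx ihy => rw [map_add]; exact add_mem ihx ihy
  | mul x y hx hy ihx ihy =>
    rw [Derivation.leibniz]
    exact add_mem (mul_mem hx ihy) (mul_mem hy ihx)

theorem mem_supported_of_dvd {σ : Type*} {s : Set σ} {q F : MvPolynomial σ k} (hF0 : F ≠ 0)
    (hF : F ∈ MvPolynomial.supported k s) (h : q ∣ F) : q ∈ MvPolynomial.supported k s := by
  obtain ⟨r, rfl⟩ := h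
  rw [MvPolynomial.mem_supported] at hF ⊢
  refine fun i hi => hF ?_
  rw [Finset.mem_coe, MvPolynomial.mem_vars_iff_degreeOf_ne_zero] at hi ⊢
  rw [MvPolynomial.degreeOf_mul_eq (left_ne_zero_of_mul hF0) (right_ne_zero_of_mul hF0)]
  omega

/-- The substitution `x₂ ↦ s`. -/
def substTwo (s : k) : MvPolynomial (Fin 3) k →ₐ[k] MvPolynomial (Fin 3) k :=
  MvPolynomial.aeval ![MvPolynomial.X 0, MvPolynomial.X 1, MvPolynomial.C s]

theorem substTwo_eq_self (s : k) {F : MvPolynomial (Fin 3) k}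
    (hF : F ∈ MvPolynomial.supported k ({0, 1} : Set (Fin 3))) : substTwo s F = F := by
  induction hF using Algebra.adjoin_induction with
  | mem x hx =>
    obtain ⟨i, hi, rfl⟩ := hx
    rcases hi with rfl | rfl <;> simp [substTwo]
  | algebraMap r => exact AlgHom.commutes _ _
  | add x y hx hy ihx ihy => rw [map_add, ihx, ihy]
  | mul x y hx hy ihx ihy => rw [map_mul, ihx, ihy]

/-- Specializing `x₂` to 0 and to 1 fixes `q`, `A` and `B`, and gives `q ∣ B` and `q ∣ B + A`. -/
theorem dvd_of_dvd_add_mul_X_pow {p : ℕ} (hp : p ≠ 0) {q A B : MvPolynomial (Fin 3) k}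
    (hq : q ∈ MvPolynomial.supported k ({0, 1} : Set (Fin 3)))
    (hA : A ∈ MvPolynomial.supported k ({0, 1} : Set (Fin 3)))
    (hB : B ∈ MvPolynomial.supported k ({0, 1} : Set (Fin 3)))
    (h : q ∣ B + A * MvPolynomial.X 2 ^ p) : q ∣ A ∧ q ∣ B := by
  have key (s : k) : q ∣ B + A * MvPolynomial.C s ^ p := by
    have := map_dvd (substTwo s) h
    rw [map_add, map_mul, map_pow, substTwo_eq_self s hq, substTwo_eq_self s hA,
      substTwo_eq_self s hB] at this
    simpa [substTwo] using this
  have h0 : q ∣ B := by simpa [hp] using key 0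
  exact ⟨(dvd_add_right h0).1 (by simpa using key 1), h0⟩

theorem not_irreducible_dvd_X_zero_X_one {q : MvPolynomial (Fin 3) k} (hq : Irreducible q)
    (h0 : q ∣ MvPolynomial.X 0) (h1 : q ∣ MvPolynomial.X 1) : False := by
  have hX : Irreducible (MvPolynomial.X 0 : MvPolynomial (Fin 3) k) :=
    MvPolynomial.X_prime.irreducible
  have h := ((hX.dvd_iff.1 h0).resolve_left hq.not_isUnit).dvd.trans h1
  exact absurd (MvPolynomial.X_dvd_X.1 h) (by decide)

theorem linForm_mem_supported (b c : Fin 2 → k) (i : Fin 2) :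
    linForm b c i ∈ MvPolynomial.supported k ({0, 1} : Set (Fin 3)) := by
  have hC (x : k) : MvPolynomial.C x ∈ MvPolynomial.supported k ({0, 1} : Set (Fin 3)) :=
    (MvPolynomial.supported k ({0, 1} : Set (Fin 3))).algebraMap_mem x
  have h0 : (MvPolynomial.X 0 : MvPolynomial (Fin 3) k) ∈ MvPolynomial.supported k {0, 1} :=
    Algebra.subset_adjoin ⟨0, by simp, rfl⟩
  have h1 : (MvPolynomial.X 1 : MvPolynomial (Fin 3) k) ∈ MvPolynomial.supported k {0, 1} :=
    Algebra.subset_adjoin ⟨1, by simp, rfl⟩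
  exact sub_mem (mul_mem (hC _) h0) (mul_mem (hC _) h1)

theorem sigmaForm_mem_supported (p : ℕ) (σ : ℕ → k) :
    sigmaForm p σ (MvPolynomial.X 0) (MvPolynomial.X 1) ∈
      MvPolynomial.supported k ({0, 1} : Set (Fin 3)) := by
  have h0 : (MvPolynomial.X 0 : MvPolynomial (Fin 3) k) ∈ MvPolynomial.supported k {0, 1} :=
    Algebra.subset_adjoin ⟨0, by simp, rfl⟩
  have h1 : (MvPolynomial.X 1 : MvPolynomial (Fin 3) k) ∈ MvPolynomial.supported k {0, 1} :=
    Algebra.subset_adjoin ⟨1, by simp, rfl⟩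
  exact sum_mem fun i _ => Subalgebra.smul_mem _ (mul_mem (pow_mem h0 _) (pow_mem h1 _)) _

variable {p : ℕ} [Fact p.Prime] [CharP k p]

/-- The full equation of a curve with `π ≠ 0` is squarefree. -/
theorem squarefree_fullEquation {σ : ℕ → k} (hσ_one : σ 1 = 1) (hσ_last : σ (p - 1) = 1)
    (d : ℕ) (a : ℕ → k) {b c : Fin 2 → k} (hπ : piCoeff b c ≠ 0) :
    Squarefree (fullEquation p σ d a b c) := by
  have hp : p ≠ 0 := (Fact.out : p.Prime).ne_zero
  set κ : k := (-1) ^ d * piCoeff b c ^ p with hκ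
  have hκ0 : κ ≠ 0 := mul_ne_zero (pow_ne_zero _ (neg_ne_zero.2 one_ne_zero)) (pow_ne_zero _ hπ)
  set P : MvPolynomial (Fin 3) k := ∏ j ∈ Finset.Icc 1 (d - p),
    (linForm b c 0 - MvPolynomial.C (a j ^ p) * linForm b c 1) with hP
  set s : MvPolynomial (Fin 3) k := sigmaForm p σ (MvPolynomial.X 0) (MvPolynomial.X 1) with hs
  set A := MvPolynomial.C κ * P with hA
  set B := linForm b c 1 ^ d - s * A with hB
  have hΨ : fullEquation p σ d a b c = B + A * MvPolynomial.X 2 ^ p := by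
    rw [fullEquation, boundaryPoly, ← hP, ← hs, hB, hA, hκ]
    simp only [MvPolynomial.C_mul, MvPolynomial.C_pow, MvPolynomial.C_neg, MvPolynomial.C_1]
    ring
  rw [hΨ]
  have hC (x : k) : MvPolynomial.C x ∈ MvPolynomial.supported k ({0, 1} : Set (Fin 3)) :=
    (MvPolynomial.supported k ({0, 1} : Set (Fin 3))).algebraMap_mem x
  have hAs : A ∈ MvPolynomial.supported k ({0, 1} : Set (Fin 3)) :=
    mul_mem (hC _) (prod_mem fun j _ => sub_mem (linForm_mem_supported b c 0)
      (mul_mem (hC _) (linForm_mem_supported b c 1)))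
  have hBs : B ∈ MvPolynomial.supported k ({0, 1} : Set (Fin 3)) :=
    sub_mem (pow_mem (linForm_mem_supported b c 1) _)
      (mul_mem (sigmaForm_mem_supported p σ) hAs)
  set D := lineDerivation b c with hD
  set Ψ := B + A * MvPolynomial.X 2 ^ p with hΨ'
  have hDΨ : D Ψ = D B + D A * MvPolynomial.X 2 ^ p := by
    have h2 : D (MvPolynomial.X 2) = 0 := by
      simp [hD, lineDerivation, MvPolynomial.mkDerivation_X]
    rw [hΨ', map_add, Derivation.leibniz, Derivation.leibniz_pow, h2]
    simp [mul_comm]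
  -- The combination of `Ψ` and `DΨ` that eliminates `x₂`.
  set T := D A * B - A * D B with hT
  have hTΨ : T = D A * Ψ - A * D Ψ := by rw [hDΨ, hT, hΨ']; ring
  have hTs : T ∈ MvPolynomial.supported k ({0, 1} : Set (Fin 3)) :=
    sub_mem (mul_mem (lineDerivation_mem_supported b c hAs) hBs)
      (mul_mem hAs (lineDerivation_mem_supported b c hBs))
  have hT0 : T ≠ 0 := by
    intro hzero
    set φ := lineRestriction b c with hφ
    have hφ1 : φ (linForm b c 1) = C (piCoeff b c) := by
      simp [hφ, lineRestriction, linForm, piCoeff]; ring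
    have hφ0 : φ (linForm b c 0) = C (piCoeff b c) * X := by
      simp [hφ, lineRestriction, linForm, piCoeff]; ring
    set u : k[X] := C (b 1) * X - C (b 0) with hu
    set v : k[X] := C (c 1) * X - C (c 0) with hv
    have hφs : φ s = sigmaForm p σ u v := by
      rw [hs, map_sigmaForm]
      simp [hφ, lineRestriction, hu, hv]
    have hφA : φ A ≠ 0 := by
      have hφC (x : k) : φ (MvPolynomial.C x) = C x := AlgHom.commutes φ x
      rw [hA, map_mul, hφC, hP, map_prod]
      refine mul_ne_zero (C_ne_zero.2 hκ0) (Finset.prod_ne_zero_iff.2 fun j _ => ?_)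
      rw [map_sub, map_mul, hφC, hφ0, hφ1, ← C_mul, mul_comm (a j ^ p), C_mul, ← mul_sub]
      exact mul_ne_zero (C_ne_zero.2 hπ) (X_sub_C_ne_zero _)
    have hS' : derivative (sigmaForm p σ u v) ≠ 0 := by
      intro h
      have huv : IsCoprime u v := by
        refine ⟨C (c 1 / piCoeff b c), -C (b 1 / piCoeff b c), ?_⟩
        have : C (c 1 / piCoeff b c) * u + -C (b 1 / piCoeff b c) * v =
            C ((b 1 * c 0 - b 0 * c 1) / piCoeff b c) := by
          rw [hu, hv, sub_div, C_sub]
          simp only [div_eq_mul_inv, C_mul]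
          ring
        rw [this, ← piCoeff, div_self hπ, C_1]
      obtain ⟨h1, h2⟩ := derivative_eq_zero_of_isCoprime hσ_one hσ_last huv h
      simp only [hu, hv, derivative_sub, derivative_mul, derivative_C, derivative_X, zero_mul,
        zero_add, mul_one, sub_zero, C_eq_zero] at h1 h2
      exact hπ (by rw [piCoeff, h1, h2]; ring)
    have h1 := congrArg φ hzero
    rw [hT, map_sub, map_mul φ (D A) B, map_mul φ A (D B), hφ, hD, lineRestriction_lineDerivation,
      lineRestriction_lineDerivation, ← hφ, hB, map_sub, map_mul φ s A, map_pow, hφ1, hφs, map_zero,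
      derivative_sub, derivative_mul, ← C_pow, derivative_C] at h1
    -- On the line, `T = 0` reads `π^d A' = -A² σ(u,v)'`, where `σ(u,v)' ≠ 0` because `u`, `v` are
    -- coprime and not both constant. Degrees contradict this, since `deg A' < deg A` unless `A` is
    -- constant.
    have h2 : C (piCoeff b c ^ d) * derivative (φ A) =
        -(φ A ^ 2 * derivative (sigmaForm p σ u v)) := by
      linear_combination h1
    have h3 : φ A ^ 2 * derivative (sigmaForm p σ u v) ≠ 0 := mul_ne_zero (pow_ne_zero _ hφA) hS'
    have h4 : (φ A).natDegree ≠ 0 := by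
      intro h0
      rw [eq_C_of_natDegree_eq_zero h0, derivative_C, mul_zero, ← eq_C_of_natDegree_eq_zero h0]
        at h2
      exact h3 (neg_eq_zero.1 h2.symm)
    have h5 := congrArg natDegree h2
    rw [natDegree_C_mul (pow_ne_zero _ hπ), natDegree_neg,
      natDegree_mul (pow_ne_zero _ hφA) hS', natDegree_pow] at h5
    have := natDegree_derivative_lt h4
    omega
  have hΨ0 : Ψ ≠ 0 := by
    intro h
    rw [h, map_zero, mul_zero, mul_zero, sub_zero] at hTΨ
    exact hT0 hTΨ
  rw [squarefree_iff_no_irreducibles hΨ0]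
  rintro q hq ⟨r, hr⟩
  have hqΨ : q ∣ Ψ := ⟨q * r, by rw [hr, mul_assoc]⟩
  have hqDΨ : q ∣ D Ψ := by
    rw [hr, Derivation.leibniz, Derivation.leibniz]
    simp only [smul_eq_mul]
    exact ⟨q * D r + r * (D q + D q), by ring⟩
  -- Since `T` is nonzero and free of `x₂`, so is its divisor `q`, which therefore divides `A` and
  -- `B` separately.
  have hqT : q ∣ T := hTΨ ▸ dvd_sub (hqΨ.mul_left _) (hqDΨ.mul_left _)
  have hqs := mem_supported_of_dvd hT0 hTs hqT
  obtain ⟨hqA, hqB⟩ := dvd_of_dvd_add_mul_X_pow hp hqs hAs hBs hqΨ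
  have hprime : Prime q := hq.prime
  have hq1 : q ∣ linForm b c 1 := by
    have : q ∣ linForm b c 1 ^ d := by
      have := dvd_add hqB (hqA.mul_left s)
      rwa [hB, sub_add_cancel] at this
    exact hprime.dvd_of_dvd_pow this
  have hunit (x : k) (hx : x ≠ 0) : IsUnit (MvPolynomial.C x : MvPolynomial (Fin 3) k) :=
    hx.isUnit.map MvPolynomial.C
  have hq0 : q ∣ linForm b c 0 := by
    have hqP : q ∣ P := (hunit κ hκ0).dvd_mul_left.1 hqA
    obtain ⟨j, -, hj⟩ := hprime.exists_mem_finset_dvd hqP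
    have := dvd_add hj (hq1.mul_left (MvPolynomial.C (a j ^ p)))
    rwa [sub_add_cancel] at this
  refine not_irreducible_dvd_X_zero_X_one hq ?_ ?_
  · rw [← (hunit _ hπ).dvd_mul_left (a := q)]
    have := dvd_sub (hq0.mul_left (MvPolynomial.C (b 1))) (hq1.mul_left (MvPolynomial.C (b 0)))
    convert this using 1
    simp only [linForm, piCoeff, MvPolynomial.C_sub, MvPolynomial.C_mul]
    ring
  · rw [← (hunit _ hπ).dvd_mul_left (a := q)]
    have := dvd_sub (hq0.mul_left (MvPolynomial.C (c 1))) (hq1.mul_left (MvPolynomial.C (c 0)))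
    convert this using 1
    simp only [linForm, piCoeff, MvPolynomial.C_sub, MvPolynomial.C_mul]
    ring

end Squarefree

/-! ### Comparison of the two equations and the ideal of the image -/

section Psi

variable {k : Type*} [Field k]

theorem Psi_eq_fullEquation {p : ℕ} (hp : p ≠ 0) (σ : ℕ → k) (d : ℕ) (a : ℕ → k)
    (b c : Fin 2 → k) (ha : d - p ≠ 0 → a (d - p) = 0) :
    Psi p σ d a b c = fullEquation p σ d a b c := by
  rw [Psi, fullEquation]
  rcases h : d - p with _ | m
  · simp
  · rw [h] at ha
    rw [if_neg (by omega), Finset.prod_Icc_succ_top (by omega), ha (by omega), zero_pow hp,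
      MvPolynomial.C_0, zero_mul, sub_zero]
    split_ifs with h1
    · obtain rfl : m = 0 := by omega
      simp
    · rw [Nat.add_sub_cancel]
      ring

/-- By the Nullstellensatz the vanishing ideal of the cone is the radical of `(F)`, and `(F)` is
radical because `F` is squarefree. -/
theorem imageIdeal_eq_span [IsAlgClosed k] {d : ℕ} (f : PlaneMap k d) {F : MvPolynomial (Fin 3) k}
    (hF : Squarefree F) (h : coneOver d f.coord = {v | MvPolynomial.eval v F = 0}) :
    f.imageIdeal = Ideal.span {F} := by
  have h1 : f.imageIdeal = MvPolynomial.vanishingIdeal k (coneOver d f.coord) := rfl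
  have h2 : {v : Fin 3 → k | MvPolynomial.eval v F = 0} =
      MvPolynomial.zeroLocus k (Ideal.span {F}) := by
    rw [MvPolynomial.zeroLocus_span]
    ext v
    simp only [Set.mem_ofPred_eq, Set.mem_singleton_iff, forall_eq]
    exact Iff.rfl
  rw [h1, h, h2, MvPolynomial.vanishingIdeal_zeroLocus_eq_radical]
  exact (isRadical_iff_span_singleton.1 hF.isRadical).radical

end Psi

end StrangeCurve

end

theorem proposition1p5 (p : ℕ) [Fact p.Prime] {k : Type*} [Field k] [IsAlgClosed k] [CharP k p]
    (σ : ℕ → k) (hσ_one : σ 1 = 1) (hσ_last : σ (p - 1) = 1)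
    (d : ℕ) (hd : p ≤ d)
    (f : StrangeCurve.PlaneMap k d) (hf : f ∈ StrangeCurve.component p σ d (d - p)) :
    (∃ (a : ℕ → k) (b c : Fin 2 → k),
      StrangeCurve.HasParameterization p σ (d - p) f a b c ∧
      (d - p ≠ 0 → a (d - p) = 0) ∧
      f.image = StrangeCurve.projZeros (StrangeCurve.Psi p σ d a b c) ∧
      (StrangeCurve.piCoeff b c ≠ 0 →
        f.imageIdeal = Ideal.span {StrangeCurve.Psi p σ d a b c})) ∧
    (∀ (a : ℕ → k) (b c : Fin 2 → k),
      StrangeCurve.HasParameterization p σ (d - p) f a b c →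
      f.image = StrangeCurve.projZeros (StrangeCurve.fullEquation p σ d a b c)) := by
  have hp : p ≠ 0 := (Fact.out : p.Prime).ne_zero
  refine ⟨?_, fun a b c h => StrangeCurve.image_eq_projZeros f _ (h.coneOver_eq hd)⟩
  obtain ⟨a, b, c, h, ha⟩ := StrangeCurve.exists_hasParameterization hσ_one hσ_last hd hf
  refine ⟨a, b, c, h, ha, ?_, fun hπ => ?_⟩
  · rw [StrangeCurve.Psi_eq_fullEquation hp σ d a b c ha]
    exact StrangeCurve.image_eq_projZeros f _ (h.coneOver_eq hd)
  · rw [StrangeCurve.Psi_eq_fullEquation hp σ d a b c ha]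
    exact StrangeCurve.imageIdeal_eq_span f
      (StrangeCurve.squarefree_fullEquation hσ_one hσ_last d a hπ) (h.coneOver_eq hd)
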